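/- **Setting.** A two-armed bandit instance with contexts in $[0,1]$ consists of a law of $(X,Y^{(1)},Y^{(-1)})$ with $X,Y^{(1)},Y^{(-1)}\in[0,1]$ and functions $f^{(k)}:[0,1]\to\mathbb R$ with $\mathbb E[Y^{(k)}\mid X]=f^{(k)}(X)$, $k\in\{1,-1\}$; the rounds $t=1,\dots,T$ are i.i.d. copies $(X_t,Y_t^{(1)},Y_t^{(-1)})$. Fix constants $0<\underline c\le1\le\bar c$, $L>0$, $\delta_0\in(0,1)$, $D_0>0$. For $\alpha>0$ let $\mathcal F(\alpha,1)$ be the class of instances such that the law $P_X$ of $X$ has a Lebesgue density with values in $[\underline c,\bar c]$, $|f^{(k)}(x)-f^{(k)}(x')|\le L|x-x'|$ for all $k,x,x'$, and $P_X(0<|f^{(1)}(X)-f^{(-1)}(X)|\le\delta)\le D_0\delta^\alpha$ for all $\delta\in[0,\delta_0]$. An $M$-batch policy $\pi$ with horizon $T$ chooses grid points $0=t_0<t_1<\dots<t_M=T$ and arms $A_1,\dots,A_T\in\{1,-1\}$, possibly using an internal random seed independent of the environment: $t_i$ is a function of the seed, the contexts $X_1,\dots,X_{t_{i-1}}$ and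 the obtained rewards $Y_1^{(A_1)},\dots,Y_{t_{i-1}}^{(A_{t_{i-1}})}$; for $t_{i-1}<t\le t_i$ the arm $A_t$ is a function of the seed, $X_1,\dots,X_t$ and the obtained rewards up to time $t_{i-1}$. Its regret on an instance is $R_T(\pi)=\mathbb E\big[\sum_{t=1}^T\big(\max_k f^{(k)}(X_t)-f^{(A_t)}(X_t)\big)\big]$. Put $\gamma(\alpha)=(\alpha+1)/3$ (which is $\beta(\alpha+1)/(2\beta+d)$ for $\beta=d=1$). **Theorem.** There are constants $\tilde D_3,\tilde D_4>0$, depending only on $\underline c,\bar c,L,\delta_0,D_0$, such that for every $M\ge2$ there is $\kappa_1>0$, depending only on $M$ and these class constants, with the following property. For every horizon $T$ and every $M$-batch policy $\pi$ with horizon $T$ (which is fixed before $\alpha^\star$ is chosen, so it does not know $\alpha^\star$) there is $\alpha^\star\in(0,1]$ such that, with $\gamma^\star=\gamma(\alpha^\star)$, $$\sup_{\mathcal F(\alpha^\star,1)}R_T(\pi)\;\ge\;\tilde D_3\,T^{\frac{1-\gamma^\star}{1-(\gamma^\star)^M}+\kappa_1}\Big(\frac1M\Big)^{\tilde D_4}.$$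 -/

import Mathlib

open MeasureTheory unitInterval

noncomputable section

/-- The exponent `γ(α) = β (α + 1) / (2 β + d)`. -/
def gammaExp (β d α : ℝ) : ℝ := β * (α + 1) / (2 * β + d)

/-- A two-armed nonparametric bandit with one-dimensional contexts `X ∈ [0,1]` and rewards in
`[0,1]`. The arms `1` and `-1` are encoded as `true` and `false`. The field `law` is the joint law
of `(X, (Y⁽¹⁾, Y⁽⁻¹⁾))` in a single round, and `f k` is the mean reward function of arm `k`. -/
structure BanditInstance where
  law : Measure (I × (Bool → I))
  isProb : IsProbabilityMeasure law
  f : Bool → I → ℝ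
  condMean : ∀ k : Bool,
    law[fun z => ((z.2 k : I) : ℝ) | MeasurableSpace.comap Prod.fst inferInstance]
      =ᵐ[law] fun z => f k z.1

namespace BanditInstance

/-- The law `P_X` of the contexts. -/
def contextLaw (P : BanditInstance) : Measure I := P.law.map Prod.fst

/-- `P_X` has a Lebesgue density with values in `[c, C]`. -/
def HasDensityBounds (P : BanditInstance) (c C : ℝ) : Prop :=
  ∃ p : I → ℝ, Measurable p ∧ (∀ x, c ≤ p x ∧ p x ≤ C) ∧
    P.contextLaw = (volume : Measure I).withDensity fun x => ENNReal.ofReal (p x)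

/-- Both mean reward functions are `(β, L)`-smooth. -/
def Smooth (P : BanditInstance) (β L : ℝ) : Prop :=
  ∀ (k : Bool) (x x' : I), |P.f k x - P.f k x'| ≤ L * |(x : ℝ) - (x' : ℝ)| ^ β

/-- The margin condition with parameter `α` and constants `δ₀`, `D₀`. -/
def Margin (P : BanditInstance) (α δ₀ D₀ : ℝ) : Prop :=
  ∀ δ : ℝ, 0 ≤ δ → δ ≤ δ₀ →
    P.contextLaw.real {x | 0 < |P.f true x - P.f false x| ∧ |P.f true x - P.f false x| ≤ δ}
      ≤ D₀ * δ ^ α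

end BanditInstance

/-- The class `𝓕(α, β)` of bandit instances, with its constants displayed. -/
def banditClass (c C L δ₀ D₀ α β : ℝ) : Set BanditInstance :=
  {P | P.HasDensityBounds c C ∧ P.Smooth β L ∧ P.Margin α δ₀ D₀}

/-- An `M`-batch policy with horizon `T`, adaptive grid, and internal randomization through a seed
in `S`. Rounds are indexed by `k : Fin T`, the index `k` standing for time `k + 1`, so that the
first `n` rounds are those with `k < n`. Decisions are functions of the seed `u`, the context
sequence `x` and the sequence `y` of rewards obtained: `grid u x y i` is the `i`-th grid point, and
`act u x y k` is the arm pulled in round `k`. The two causality fields say that these functions use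
the available information only. -/
structure BatchedPolicy (T M : ℕ) (S : Type*) [MeasurableSpace S] where
  grid : S → (Fin T → I) → (Fin T → I) → ℕ → ℕ
  act : S → (Fin T → I) → (Fin T → I) → Fin T → Bool
  measurable_grid : ∀ i ≤ M,
    Measurable fun p : S × (Fin T → I) × (Fin T → I) => grid p.1 p.2.1 p.2.2 i
  measurable_act : ∀ k : Fin T,
    Measurable fun p : S × (Fin T → I) × (Fin T → I) => act p.1 p.2.1 p.2.2 k
  grid_zero : ∀ u x y, grid u x y 0 = 0
  grid_last : ∀ u x y, grid u x y M = T
  grid_lt : ∀ u x y, ∀ i < M, grid u x y i < grid u x y (i + 1)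
  /-- The next grid point depends on the contexts and rewards up to the current one only. -/
  grid_causal : ∀ u x y x' y', ∀ i < M,
    (∀ l : Fin T, (l : ℕ) < grid u x y i → x l = x' l ∧ y l = y' l) →
    grid u x y (i + 1) = grid u x' y' (i + 1)
  /-- In a given batch, the arm pulled depends on the contexts up to the present round and the
  rewards of the previous batches only. -/
  act_causal : ∀ u x y x' y', ∀ i < M, ∀ k : Fin T,
    grid u x y i ≤ (k : ℕ) → (k : ℕ) < grid u x y (i + 1) →
    (∀ l : Fin T, l ≤ k → x l = x' l) →
    (∀ l : Fin T, (l : ℕ) < grid u x y i → y l = y' l) →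
    act u x y k = act u x' y' k

namespace BatchedPolicy

variable {T M : ℕ} {S : Type*} [MeasurableSpace S]

/-- The sequence of rewards obtained when the policy is run with seed `u` on the contexts and
potential rewards `z`. It is the unique `y` with `y k = (z k).2 (act u x y k)` for all `k`, where
`x` is the sequence of contexts (see `observed_apply` and `eq_observed`); since `act` at round `k`
only looks at rewards of earlier rounds, `T` iterations from any sequence reach it. -/
def observed (π : BatchedPolicy T M S) (u : S) (z : Fin T → I × (Bool → I)) : Fin T → I :=
  (fun (y : Fin T → I) (k : Fin T) => (z k).2 (π.act u (fun j => (z j).1) y k))^[T] fun _ => 0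

/-- The arm pulled in round `k`. -/
def action (π : BatchedPolicy T M S) (u : S) (z : Fin T → I × (Bool → I)) (k : Fin T) : Bool :=
  π.act u (fun j => (z j).1) (π.observed u z) k

/-- The expected cumulative regret of the policy `π`, with seed distribution `ν`, on the
instance `P`, the rounds being independent with law `P.law`. -/
def regret (π : BatchedPolicy T M S) (ν : Measure S) (P : BanditInstance) : ℝ :=
  ∫ ω : S × (Fin T → I × (Bool → I)),
    ∑ k : Fin T, (max (P.f true (ω.2 k).1) (P.f false (ω.2 k).1)
      - P.f (π.action ω.1 ω.2 k) (ω.2 k).1)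
    ∂(ν.prod (Measure.pi fun _ : Fin T => P.law))

/-- The arm in round `k` does not depend on the rewards of round `k` or later. -/
theorem act_congr (π : BatchedPolicy T M S) (u : S) (x y y' : Fin T → I) (k : Fin T)
    (h : ∀ l : Fin T, l < k → y l = y' l) : π.act u x y k = π.act u x y' k := by
  have key : ∀ n, n ≤ M → (k : ℕ) < π.grid u x y n →
      ∃ i < n, π.grid u x y i ≤ (k : ℕ) ∧ (k : ℕ) < π.grid u x y (i + 1) := by
    intro n
    induction n with
    | zero => intro _ hk; rw [π.grid_zero] at hk; omega
    | succ n ih =>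
      intro hn hk
      by_cases hk' : (k : ℕ) < π.grid u x y n
      · obtain ⟨i, hi, h1⟩ := ih (by omega) hk'
        exact ⟨i, by omega, h1⟩
      · exact ⟨n, by omega, by omega, hk⟩
  obtain ⟨i, hi, h1, h2⟩ := key M le_rfl (by rw [π.grid_last]; exact k.2)
  exact π.act_causal u x y x y' i hi k h1 h2 (fun _ _ => rfl)
    fun l hl => h l (Fin.lt_def.2 (lt_of_lt_of_le hl h1))

theorem eq_observed (π : BatchedPolicy T M S) (u : S) (z : Fin T → I × (Bool → I))
    (y : Fin T → I) (hy : ∀ k, y k = (z k).2 (π.act u (fun j => (z j).1) y k)) :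
    y = π.observed u z := by
  have key : ∀ (n : ℕ) (k : Fin T), (k : ℕ) < n →
      ((fun (y : Fin T → I) (k : Fin T) =>
        (z k).2 (π.act u (fun j => (z j).1) y k))^[n] fun _ => 0) k = y k := by
    intro n
    induction n with
    | zero => intro k hk; omega
    | succ n ih =>
      intro k hk
      rw [Function.iterate_succ_apply', hy k]
      exact congrArg _ (π.act_congr u _ _ _ k fun l hl => ih l (by have := Fin.lt_def.1 hl; omega))
  funext k
  exact (key T k k.2).symm

theorem observed_apply (π : BatchedPolicy T M S) (u : S) (z : Fin T → I × (Bool → I))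
    (k : Fin T) : π.observed u z k = (z k).2 (π.action u z k) := by
  set F := fun (y : Fin T → I) (k : Fin T) => (z k).2 (π.act u (fun j => (z j).1) y k) with hF
  have key : ∀ (n : ℕ) (k : Fin T), (k : ℕ) < n →
      (F^[n] fun _ => 0) k = (F^[n + 1] fun _ => 0) k := by
    intro n
    induction n with
    | zero => intro k hk; omega
    | succ n ih =>
      intro k hk
      rw [Function.iterate_succ_apply', Function.iterate_succ_apply' F (n + 1)]
      exact congrArg _ (π.act_congr u _ _ _ k fun l hl => ih l (by have := Fin.lt_def.1 hl; omega))
  have h := key T k k.2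
  rw [Function.iterate_succ_apply'] at h
  exact h

end BatchedPolicy

end

/-! Only two margins are played against each other: `α = 1/2`, where `γ = 1/2`, and `α = 1`, where
`γ = 2/3`. Let `e₁` and `e₂` be the corresponding optimal exponents; then `e₂ < e₁`. When the gap is
constant, which every margin allows, a first batch of length `n` costs order `n`, so a policy good
at `α = 1` must end it by about `T ^ e₂`. At `α = 1/2`, a batch that starts by time `n` and runs
past `N` costs about `(N - n) / √n`, so grid points must essentially satisfy `t (i + 1) ≤ √(t i) * T
^ e₁`. The exponent `e₁` is exactly the one for which this recursion, started at `T ^ e₁`, reaches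
`T` after `M` batches. Started at `T ^ e₂` it falls short of `T`, and the shortfall leaves room for
a gain `κ₁` in both exponents (`timeExp_last_lt_one`).

Fix the times `τ` given by the recursion with the gain included. Since `τ M < T`, on every sample
path some batch starts by `τ i` and ends after `τ (i + 1)` (`exists_mem_longBatch`). The grid is
adaptive, so which batch this is may depend on the data and on the instance. For this reason the
instances for `α = 1/2` form a single hypercube carrying tents of `M` sizes at once (`levelFamily`),
the size of level `i` being tuned to be undetectable in `τ i` rounds. Averaged over all signs, one
index `i` has probability at least `1 / M` (`exists_longBatchMass_ge`). If `i ≥ 1`, the tents of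
level `i` force the regret (`exists_regret_ge_of_longBatch`). If `i = 0`, the length of the first
batch depends on the seed alone, so the same probability holds under a constant gap.

The statistical core is a two-point argument for each tent (`BumpFamily.sum_integral_wrongArm_ge`).
The rewards of the two arms are complementary coin flips, so the bound even allows the whole reward
vectors of earlier rounds to be seen. The event of a long batch is determined by the rounds before
`n`, and a second-moment bound for likelihoods (`integral_abs_lik_sub_le`) shows that flipping the
sign of a tent is hardly visible in them. The loss in `M` is a fifth power: four factors from the
mass of the tents of one level, one from the probability `1 / M`. For horizons too small to separate
the critical times, a plain `√T` bound suffices (`exists_regret_ge_sqrt`). -/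

/-! ### Product measures -/

section ProductMeasures

variable {ι α : Type*} [Fintype ι] [MeasurableSpace α]

theorem integrable_of_forall_abs_le {μ : Measure α} [IsFiniteMeasure μ] {F : α → ℝ} {C : ℝ}
    (hF : Measurable F) (hC : ∀ a, |F a| ≤ C) : Integrable F μ :=
  Integrable.of_bound hF.aestronglyMeasurable C (Filter.Eventually.of_forall hC)

/-- This moves the laws of all instances to the single base measure `baseRounds`, with `lik` as
density, where they can be compared pointwise. -/
theorem pi_withDensity (μ : Measure α) [IsProbabilityMeasure μ] {w : α → ENNReal}
    (hw : Measurable w) [SigmaFinite (μ.withDensity w)] :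
    Measure.pi (fun _ : ι => μ.withDensity w)
      = (Measure.pi fun _ : ι => μ).withDensity fun z => ∏ i, w (z i) := by
  classical
  refine Measure.pi_eq fun s hs => ?_
  rw [withDensity_apply _ (MeasurableSet.univ_pi hs),
    ← lintegral_indicator (MeasurableSet.univ_pi hs)]
  have h1 : ∀ z : ι → α, (Set.univ.pi s).indicator (fun z => ∏ i, w (z i)) z
      = ∏ i, (s i).indicator w (z i) := by
    intro z
    by_cases hz : z ∈ Set.univ.pi s
    · rw [Set.indicator_of_mem hz]
      exact Finset.prod_congr rfl fun i _ => (Set.indicator_of_mem (hz i trivial) _).symm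
    · rw [Set.indicator_of_notMem hz]
      obtain ⟨i, hi⟩ : ∃ i, z i ∉ s i := by simpa [Set.mem_pi] using hz
      exact (Finset.prod_eq_zero (Finset.mem_univ i) (Set.indicator_of_notMem hi _)).symm
  simp_rw [h1]
  have hind := ProbabilityTheory.iIndepFun_pi (μ := fun _ : ι => μ)
    (X := fun i => (s i).indicator w) fun i => (hw.indicator (hs i)).aemeasurable
  rw [ProbabilityTheory.lintegral_prod_eq_prod_lintegral_of_indepFun Finset.univ _ hind
    fun i => (hw.indicator (hs i)).comp (measurable_pi_apply i)]
  refine Finset.prod_congr rfl fun i _ => ?_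
  rw [withDensity_apply _ (hs i), ← lintegral_indicator (hs i)]
  exact (measurePreserving_eval (fun _ : ι => μ) i).lintegral_comp (hw.indicator (hs i))

/-- Resampling one coordinate preserves a product of probability measures. -/
theorem measurePreserving_update [DecidableEq ι] (μ : Measure α) [IsProbabilityMeasure μ] (k : ι) :
    MeasurePreserving (fun p : (ι → α) × α => Function.update p.1 k p.2)
      ((Measure.pi fun _ : ι => μ).prod μ) (Measure.pi fun _ : ι => μ) := by
  have hm : Measurable fun p : (ι → α) × α => Function.update p.1 k p.2 := by
    refine measurable_pi_iff.2 fun i => ?_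
    by_cases h : i = k
    · subst h; simpa using measurable_snd
    · simp only [Function.update_of_ne h]
      exact (measurable_pi_apply i).comp measurable_fst
  refine ⟨hm, (Measure.pi_eq fun s hs => ?_).symm⟩
  rw [Measure.map_apply hm (MeasurableSet.univ_pi hs)]
  have : (fun p : (ι → α) × α => Function.update p.1 k p.2) ⁻¹' Set.univ.pi s
      = (Set.univ.pi (Function.update s k Set.univ)) ×ˢ s k := by
    ext p
    simp only [Set.mem_preimage, Set.mem_pi, Set.mem_univ, true_imp_iff, Set.mem_prod]
    constructor
    · intro h
      refine ⟨fun i => ?_, by simpa using h k⟩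
      by_cases hi : i = k
      · subst hi; simp
      · simpa [Function.update_of_ne hi] using h i
    · rintro ⟨h1, h2⟩ i
      by_cases hi : i = k
      · subst hi; simpa using h2
      · simpa [Function.update_of_ne hi] using h1 i
  rw [this, Measure.prod_prod, Measure.pi_pi, ← Finset.mul_prod_erase _ _ (Finset.mem_univ k),
    ← Finset.mul_prod_erase _ (fun i => μ (s i)) (Finset.mem_univ k)]
  simp only [Function.update_self, measure_univ, one_mul]
  rw [mul_comm]
  congr 1
  refine Finset.prod_congr rfl fun i hi => ?_
  rw [Function.update_of_ne (Finset.ne_of_mem_erase hi)]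

/-- A function of one coordinate is independent of a function which ignores that coordinate. -/
theorem integral_pi_mul_of_update [DecidableEq ι] (μ : Measure α) [IsProbabilityMeasure μ] (k : ι)
    {ψ : α → ℝ} {H : (ι → α) → ℝ} (hψ : Measurable ψ) (hH : Measurable H)
    (hup : ∀ z a, H (Function.update z k a) = H z) :
    ∫ z, ψ (z k) * H z ∂(Measure.pi fun _ : ι => μ)
      = (∫ a, ψ a ∂μ) * ∫ z, H z ∂(Measure.pi fun _ : ι => μ) := by
  have hmp := measurePreserving_update (ι := ι) μ k
  have hm : Measurable fun z : ι → α => ψ (z k) * H z := (hψ.comp (measurable_pi_apply k)).mul hH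
  have h := integral_map (μ := (Measure.pi fun _ : ι => μ).prod μ) hmp.measurable.aemeasurable
    hm.aestronglyMeasurable
  rw [hmp.map_eq] at h
  rw [h]
  simp only [Function.update_self, hup]
  rw [mul_comm, ← integral_prod_mul]
  simp only [mul_comm]

theorem integral_pi_prod (μ : Measure α) [IsProbabilityMeasure μ] (J : Finset ι) (q : α → ℝ) :
    ∫ z, ∏ k ∈ J, q (z k) ∂(Measure.pi fun _ : ι => μ) = (∫ a, q a ∂μ) ^ J.card := by
  classical
  have h := integral_fintype_prod_eq_prod (μ := fun _ : ι => μ) (𝕜 := ℝ)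
    (fun k a => if k ∈ J then q a else 1)
  have h1 : ∀ z : ι → α, ∏ k, (if k ∈ J then q (z k) else 1) = ∏ k ∈ J, q (z k) := by
    intro z; rw [Finset.prod_ite_mem, Finset.univ_inter]
  simp only [h1] at h
  rw [h, ← Finset.prod_const, ← Finset.univ_inter J, ← Finset.prod_ite_mem]
  refine Finset.prod_congr rfl fun k _ => ?_
  by_cases hk : k ∈ J <;> simp [hk]

end ProductMeasures

/-! ### Bandit instances with complementary coin-flip rewards -/

/-- The reward vector in which arm `s` earns `1` and the other arm earns `0`. -/
def winVec (s : Bool) : Bool → I := fun k => if k = s then 1 else 0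

/-- A fair coin decides which of the two arms earns `1`. -/
noncomputable def coinLaw : Measure (Bool → I) :=
  (2⁻¹ : ENNReal) • Measure.dirac (winVec true) + (2⁻¹ : ENNReal) • Measure.dirac (winVec false)

instance : IsProbabilityMeasure coinLaw where
  measure_univ := by simp [coinLaw, ENNReal.inv_two_add_inv_two]

/-- Uniform contexts, with rewards decided by an independent fair coin. -/
noncomputable def baseLaw : Measure (I × (Bool → I)) := volume.prod coinLaw

instance : IsProbabilityMeasure baseLaw := by unfold baseLaw; infer_instance

/-- The difference of the rewards of the two arms. -/
def rewardSign (z : I × (Bool → I)) : ℝ := (z.2 true : ℝ) - z.2 false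

/-- Exchange the rewards of the two arms. -/
def swapRewards (z : I × (Bool → I)) : I × (Bool → I) := (z.1, fun k => z.2 (!k))

theorem measurable_rewardSign : Measurable rewardSign := by
  unfold rewardSign; fun_prop

theorem abs_rewardSign_le (z : I × (Bool → I)) : |rewardSign z| ≤ 1 := by
  unfold rewardSign
  have h1 := (z.2 true).2.1; have h2 := (z.2 true).2.2
  have h3 := (z.2 false).2.1; have h4 := (z.2 false).2.2
  rw [abs_le]; constructor <;> linarith

theorem rewardSign_swapRewards (z : I × (Bool → I)) :
    rewardSign (swapRewards z) = -rewardSign z := by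
  simp [rewardSign, swapRewards]

theorem measurePreserving_swapRewards : MeasurePreserving swapRewards baseLaw baseLaw := by
  have hm : Measurable fun y : Bool → I => fun k => y (!k) := by fun_prop
  have hcoin : MeasurePreserving (fun y : Bool → I => fun k => y (!k)) coinLaw coinLaw := by
    refine ⟨hm, ?_⟩
    have e1 : (fun k => winVec true (!k)) = winVec false := by
      funext k; cases k <;> simp [winVec]
    have e2 : (fun k => winVec false (!k)) = winVec true := by
      funext k; cases k <;> simp [winVec]
    rw [coinLaw, Measure.map_add _ _ hm, Measure.map_smul, Measure.map_smul,
      Measure.map_dirac' hm, Measure.map_dirac' hm, e1, e2, add_comm]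
  exact (MeasurePreserving.id volume).prod hcoin

theorem integral_baseLaw {F : I × (Bool → I) → ℝ} (hF : Measurable F) {C : ℝ}
    (hC : ∀ z, |F z| ≤ C) :
    ∫ z, F z ∂baseLaw = ∫ x : I, (F (x, winVec true) + F (x, winVec false)) / 2 := by
  rw [baseLaw, integral_prod _ (integrable_of_forall_abs_le hF hC)]
  refine integral_congr_ae (Filter.Eventually.of_forall fun x => ?_)
  have hint : ∀ s, Integrable (fun y => F (x, y)) ((2⁻¹ : ENNReal) • Measure.dirac (winVec s)) :=
    fun s => Integrable.smul_measure (integrable_of_forall_abs_le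
      (hF.comp measurable_prodMk_left) fun y => hC (x, y)) (by simp)
  simp only [coinLaw]
  rw [integral_add_measure (hint _) (hint _), integral_smul_measure, integral_smul_measure,
    integral_dirac, integral_dirac]
  simp
  ring

theorem rewardSign_winVec_true (x : I) : rewardSign (x, winVec true) = 1 := by
  simp [rewardSign, winVec]

theorem rewardSign_winVec_false (x : I) : rewardSign (x, winVec false) = -1 := by
  simp [rewardSign, winVec]

/-- The likelihood of one round when the gap between the arms is `G`, relative to a fair coin. -/
def roundLik (G : I → ℝ) (z : I × (Bool → I)) : ℝ := 1 + G z.1 * rewardSign z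

theorem measurable_roundLik {G : I → ℝ} (hG : Measurable G) : Measurable (roundLik G) :=
  measurable_const.add ((hG.comp measurable_fst).mul measurable_rewardSign)

theorem abs_mul_rewardSign_le {G : I → ℝ} (hG1 : ∀ x, |G x| ≤ 1) (z : I × (Bool → I)) :
    |G z.1 * rewardSign z| ≤ 1 := by
  rw [abs_mul]
  exact mul_le_one₀ (hG1 _) (abs_nonneg _) (abs_rewardSign_le z)

theorem roundLik_nonneg {G : I → ℝ} (hG1 : ∀ x, |G x| ≤ 1) (z : I × (Bool → I)) :
    0 ≤ roundLik G z := by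
  have := (abs_le.1 (abs_mul_rewardSign_le hG1 z)).1
  unfold roundLik; linarith

theorem roundLik_le_two {G : I → ℝ} (hG1 : ∀ x, |G x| ≤ 1) (z : I × (Bool → I)) :
    roundLik G z ≤ 2 := by
  have := (abs_le.1 (abs_mul_rewardSign_le hG1 z)).2
  unfold roundLik; linarith

theorem abs_roundLik_le_two {G : I → ℝ} (hG1 : ∀ x, |G x| ≤ 1) (z : I × (Bool → I)) :
    |roundLik G z| ≤ 2 := by
  rw [abs_of_nonneg (roundLik_nonneg hG1 z)]; exact roundLik_le_two hG1 z

/-- The law of one round when the gap between the arms is `G`. -/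
noncomputable def gapLaw (G : I → ℝ) : Measure (I × (Bool → I)) :=
  baseLaw.withDensity fun z => ENNReal.ofReal (roundLik G z)

theorem integral_gapLaw {G : I → ℝ} (hG : Measurable G) (hG1 : ∀ x, |G x| ≤ 1)
    {F : I × (Bool → I) → ℝ} (hF : Measurable F) {C : ℝ} (hC : ∀ z, |F z| ≤ C) :
    ∫ z, F z ∂gapLaw G
      = ∫ x : I, ((1 + G x) * F (x, winVec true) + (1 - G x) * F (x, winVec false)) / 2 := by
  rw [gapLaw, integral_withDensity_eq_integral_toReal_smul
    (measurable_roundLik hG).ennreal_ofReal (by simp)]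
  simp only [ENNReal.toReal_ofReal (roundLik_nonneg hG1 _), smul_eq_mul]
  have hm : Measurable fun z => roundLik G z * F z := (measurable_roundLik hG).mul hF
  rw [integral_baseLaw hm (C := 2 * C)]
  · simp only [roundLik, rewardSign_winVec_true, rewardSign_winVec_false]
    refine integral_congr_ae (Filter.Eventually.of_forall fun x => ?_)
    simp only [mul_one, mul_neg, ← sub_eq_add_neg]
  · intro z
    rw [abs_mul]
    exact mul_le_mul (abs_roundLik_le_two hG1 z) (hC z) (abs_nonneg _) (by norm_num)

/-- The gap tilts the coin but not the context: `1 + G x` and `1 - G x` average to `1`. -/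
theorem map_fst_gapLaw {G : I → ℝ} (hG : Measurable G) (hG1 : ∀ x, |G x| ≤ 1) :
    (gapLaw G).map Prod.fst = volume := by
  ext A hA
  rw [Measure.map_apply measurable_fst hA, gapLaw, withDensity_apply _ (measurable_fst hA)]
  have hint : Integrable (roundLik G) (baseLaw.restrict (Prod.fst ⁻¹' A)) :=
    integrable_of_forall_abs_le (measurable_roundLik hG) (abs_roundLik_le_two hG1)
  rw [← ofReal_integral_eq_lintegral_ofReal hint
    (Filter.Eventually.of_forall (roundLik_nonneg hG1)),
    ← integral_indicator (measurable_fst hA),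
    integral_baseLaw (C := 2) ((measurable_roundLik hG).indicator (measurable_fst hA))]
  · have : ∀ x : I, ((Prod.fst ⁻¹' A : Set (I × (Bool → I))).indicator (roundLik G) (x, winVec true)
        + (Prod.fst ⁻¹' A : Set (I × (Bool → I))).indicator (roundLik G) (x, winVec false)) / 2
        = A.indicator (fun _ => (1 : ℝ)) x := by
      intro x
      by_cases hx : x ∈ A
      · rw [Set.indicator_of_mem (by simpa using hx), Set.indicator_of_mem (by simpa using hx),
          Set.indicator_of_mem hx]
        simp only [roundLik, rewardSign_winVec_true, rewardSign_winVec_false]; ring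
      · rw [Set.indicator_of_notMem (by simpa using hx),
          Set.indicator_of_notMem (by simpa using hx),
          Set.indicator_of_notMem hx]; simp
    simp only [this]
    rw [integral_indicator hA]
    simp
  · intro z
    classical
    rw [Set.indicator_apply]; split_ifs
    · exact abs_roundLik_le_two hG1 z
    · simp

theorem isProbabilityMeasure_gapLaw {G : I → ℝ} (hG : Measurable G) (hG1 : ∀ x, |G x| ≤ 1) :
    IsProbabilityMeasure (gapLaw G) := by
  constructor
  have h := congrArg (fun μ => μ Set.univ) (map_fst_gapLaw hG hG1)
  simpa [Measure.map_apply measurable_fst MeasurableSet.univ] using h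

/-- The mean reward of arm `k` when the gap between the arms is `G`. -/
noncomputable def gapMean (G : I → ℝ) (k : Bool) (x : I) : ℝ :=
  if k then (1 + G x) / 2 else (1 - G x) / 2

theorem measurable_gapMean {G : I → ℝ} (hG : Measurable G) (k : Bool) :
    Measurable (gapMean G k) := by
  unfold gapMean; cases k <;> simp <;> fun_prop

theorem abs_gapMean_le {G : I → ℝ} (hG1 : ∀ x, |G x| ≤ 1) (k : Bool) (x : I) :
    |gapMean G k x| ≤ 1 := by
  have h := abs_le.1 (hG1 x)
  rw [abs_le]
  cases k <;> simp only [gapMean] <;> constructor <;> simp <;> linarith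

/-- The instance with uniform contexts in which arm `true` wins a unit reward with probability
`(1 + G x) / 2` and arm `false` wins it otherwise. -/
noncomputable def gapInstance (G : I → ℝ) (hG : Measurable G) (hG1 : ∀ x, |G x| ≤ 1) :
    BanditInstance where
  law := gapLaw G
  isProb := isProbabilityMeasure_gapLaw hG hG1
  f := gapMean G
  condMean := by
    intro k
    have := isProbabilityMeasure_gapLaw hG hG1
    have hY : Measurable fun z : I × (Bool → I) => ((z.2 k : I) : ℝ) := by fun_prop
    have hYb : ∀ z : I × (Bool → I), |((z.2 k : I) : ℝ)| ≤ 1 := fun z => by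
      rw [abs_of_nonneg (z.2 k).2.1]; exact (z.2 k).2.2
    have hM : Measurable fun z : I × (Bool → I) => gapMean G k z.1 :=
      (measurable_gapMean hG k).comp measurable_fst
    symm
    refine ae_eq_condExp_of_forall_setIntegral_eq measurable_fst.comap_le
      (integrable_of_forall_abs_le hY hYb) ?_ ?_ ?_
    · intro s _ _
      exact (integrable_of_forall_abs_le hM fun z => abs_gapMean_le hG1 k z.1).integrableOn
    · rintro s ⟨A, hA, rfl⟩ _
      rw [← integral_indicator (measurable_fst hA), ← integral_indicator (measurable_fst hA),
        integral_gapLaw hG hG1 (C := 1) (hM.indicator (measurable_fst hA)),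
        integral_gapLaw hG hG1 (C := 1) (hY.indicator (measurable_fst hA))]
      · refine integral_congr_ae (Filter.Eventually.of_forall fun x => ?_)
        by_cases hx : x ∈ A
        · simp only [Set.indicator_of_mem (show (x, winVec true) ∈ Prod.fst ⁻¹' A from hx),
            Set.indicator_of_mem (show (x, winVec false) ∈ Prod.fst ⁻¹' A from hx)]
          cases k <;> simp [gapMean, winVec] <;> ring
        · simp only [Set.indicator_of_notMem (show (x, winVec true) ∉ Prod.fst ⁻¹' A from hx),
            Set.indicator_of_notMem (show (x, winVec false) ∉ Prod.fst ⁻¹' A from hx)]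
      · intro z
        classical
        rw [Set.indicator_apply]; split_ifs
        · exact hYb z
        · simp
      · intro z
        classical
        rw [Set.indicator_apply]; split_ifs
        · exact abs_gapMean_le hG1 k z.1
        · simp
    · have : Measurable[MeasurableSpace.comap Prod.fst inferInstance]
          fun z : I × (Bool → I) => gapMean G k z.1 :=
        (measurable_gapMean hG k).comp (comap_measurable _)
      exact this.aestronglyMeasurable

theorem contextLaw_gapInstance {G : I → ℝ} (hG : Measurable G) (hG1 : ∀ x, |G x| ≤ 1) :
    (gapInstance G hG hG1).contextLaw = volume := map_fst_gapLaw hG hG1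

/-- Each mean is `1/2` plus or minus half the gap, so the gap may have slope `2 * L`. The uniform
density `1` lies between `c` and `C`. -/
theorem gapInstance_mem_banditClass {G : I → ℝ} (hG : Measurable G) (hG1 : ∀ x, |G x| ≤ 1)
    {c C L δ₀ D₀ α : ℝ} (hc : c ≤ 1) (hC : 1 ≤ C)
    (hlip : ∀ x x' : I, |G x - G x'| ≤ 2 * L * |(x : ℝ) - x'|)
    (hmargin : ∀ δ, 0 ≤ δ → δ ≤ δ₀ →
      (volume : Measure I).real {x | 0 < |G x| ∧ |G x| ≤ δ} ≤ D₀ * δ ^ α) :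
    gapInstance G hG hG1 ∈ banditClass c C L δ₀ D₀ α 1 := by
  refine ⟨⟨fun _ => 1, measurable_const, fun _ => ⟨hc, hC⟩, ?_⟩, ?_, ?_⟩
  · rw [contextLaw_gapInstance]; simp
  · intro k x x'
    have h := hlip x x'
    rw [Real.rpow_one]
    have e : |gapMean G k x - gapMean G k x'| = |G x - G x'| / 2 := by
      cases k
      · rw [show gapMean G false x - gapMean G false x' = -((G x - G x') / 2) by
          simp [gapMean]; ring, abs_neg, abs_div, abs_two]
      · rw [show gapMean G true x - gapMean G true x' = (G x - G x') / 2 by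
          simp [gapMean]; ring, abs_div, abs_two]
    change |gapMean G k x - gapMean G k x'| ≤ _
    rw [e]; linarith
  · intro δ h0 h1
    have e : ∀ x, (gapInstance G hG hG1).f true x - (gapInstance G hG hG1).f false x = G x := by
      intro x; change gapMean G true x - gapMean G false x = G x; simp [gapMean]; ring
    rw [contextLaw_gapInstance]
    simp only [e]
    exact hmargin δ h0 h1

/-! ### Likelihoods of several rounds -/

section Likelihood

variable {T : ℕ}

/-- The law of all rounds when rewards are decided by fair coins. -/
noncomputable abbrev baseRounds (T : ℕ) : Measure (Fin T → I × (Bool → I)) :=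
  Measure.pi fun _ => baseLaw

/-- The likelihood of the rounds in `J` when the gap is `G`, relative to fair coins. -/
def lik (G : I → ℝ) (J : Finset (Fin T)) (z : Fin T → I × (Bool → I)) : ℝ :=
  ∏ k ∈ J, roundLik G (z k)

theorem measurable_lik {G : I → ℝ} (hG : Measurable G) (J : Finset (Fin T)) :
    Measurable (lik G J) :=
  Finset.measurable_prod _ fun k _ => (measurable_roundLik hG).comp (measurable_pi_apply k)

theorem lik_nonneg {G : I → ℝ} (hG1 : ∀ x, |G x| ≤ 1) (J : Finset (Fin T))
    (z : Fin T → I × (Bool → I)) : 0 ≤ lik G J z :=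
  Finset.prod_nonneg fun k _ => roundLik_nonneg hG1 (z k)

theorem abs_lik_le {G : I → ℝ} (hG1 : ∀ x, |G x| ≤ 1) (J : Finset (Fin T))
    (z : Fin T → I × (Bool → I)) : |lik G J z| ≤ 2 ^ J.card := by
  rw [lik, Finset.abs_prod, ← Finset.prod_const]
  exact Finset.prod_le_prod (fun _ _ => abs_nonneg _) fun k _ => abs_roundLik_le_two hG1 (z k)

theorem lik_congr (G : I → ℝ) {J : Finset (Fin T)} {z z' : Fin T → I × (Bool → I)}
    (h : ∀ k ∈ J, z k = z' k) : lik G J z = lik G J z' :=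
  Finset.prod_congr rfl fun k hk => by rw [h k hk]

theorem integrable_mul_lik {G : I → ℝ} (hG : Measurable G) (hG1 : ∀ x, |G x| ≤ 1)
    (J : Finset (Fin T)) {F : (Fin T → I × (Bool → I)) → ℝ} (hF : Measurable F) {C : ℝ}
    (hC : ∀ z, |F z| ≤ C) : Integrable (fun z => F z * lik G J z) (baseRounds T) :=
  integrable_of_forall_abs_le (C := C * 2 ^ J.card) (hF.mul (measurable_lik hG J)) fun z => by
    rw [abs_mul]
    exact mul_le_mul (hC z) (abs_lik_le hG1 J z) (abs_nonneg _) ((abs_nonneg _).trans (hC z))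

/-- Exchange the rewards of the two arms in round `k`. -/
def swapAt (k : Fin T) (z : Fin T → I × (Bool → I)) : Fin T → I × (Bool → I) :=
  fun i => (if i = k then swapRewards else id) (z i)

theorem swapAt_self (k : Fin T) (z : Fin T → I × (Bool → I)) :
    swapAt k z k = swapRewards (z k) := by simp [swapAt]

theorem swapAt_of_ne {k i : Fin T} (h : i ≠ k) (z : Fin T → I × (Bool → I)) :
    swapAt k z i = z i := by simp [swapAt, h]

theorem swapAt_fst (k i : Fin T) (z : Fin T → I × (Bool → I)) : (swapAt k z i).1 = (z i).1 := by
  by_cases h : i = k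
  · subst h; rw [swapAt_self]; rfl
  · rw [swapAt_of_ne h]

theorem measurePreserving_swapAt (k : Fin T) :
    MeasurePreserving (swapAt k) (baseRounds T) (baseRounds T) :=
  measurePreserving_pi (fun _ => baseLaw) (fun _ => baseLaw)
    (f := fun i => if i = k then swapRewards else id) fun i => by
      by_cases h : i = k
      · simpa [h] using measurePreserving_swapRewards
      · simpa [h] using MeasurePreserving.id baseLaw

theorem integral_eq_zero_of_swapAt (k : Fin T) {F : (Fin T → I × (Bool → I)) → ℝ}
    (hF : Measurable F) (h : ∀ z, F (swapAt k z) = -F z) : ∫ z, F z ∂baseRounds T = 0 := by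
  have hmp := measurePreserving_swapAt k
  have h1 := integral_map (μ := baseRounds T) hmp.measurable.aemeasurable hF.aestronglyMeasurable
  rw [hmp.map_eq] at h1
  simp only [h, integral_neg] at h1
  linarith

/-- The likelihood of rounds whose rewards are not looked at can be dropped. -/
theorem integral_mul_lik_union {G : I → ℝ} (hG : Measurable G) (hG1 : ∀ x, |G x| ≤ 1)
    {F : (Fin T → I × (Bool → I)) → ℝ} (hF : Measurable F) {C : ℝ} (hC : ∀ z, |F z| ≤ C)
    (J K : Finset (Fin T)) (hJK : Disjoint J K) (hK : ∀ l ∈ K, ∀ z, F (swapAt l z) = F z) :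
    ∫ z, F z * lik G (J ∪ K) z ∂baseRounds T = ∫ z, F z * lik G J z ∂baseRounds T := by
  induction K using Finset.induction_on with
  | empty => simp
  | insert l K hl ih =>
    have hJl : l ∉ J := fun h => Finset.disjoint_left.1 hJK h (Finset.mem_insert_self _ _)
    have hlJK : l ∉ J ∪ K := by simp [hl, hJl]
    rw [← ih (hJK.mono_right (Finset.subset_insert _ _))
      fun i hi => hK i (Finset.mem_insert_of_mem hi)]
    -- The factor of round `l` is `1 + G * rewardSign`. Its second term is odd under the exchange of
    -- rewards in round `l`, while everything else is even, so this term integrates to zero.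
    set R : (Fin T → I × (Bool → I)) → ℝ := fun z =>
      F z * lik G (J ∪ K) z * (G (z l).1 * rewardSign (z l)) with hR
    have hRm : Measurable R := (hF.mul (measurable_lik hG _)).mul
      ((hG.comp (measurable_fst.comp (measurable_pi_apply l))).mul
        (measurable_rewardSign.comp (measurable_pi_apply l)))
    have hR0 : ∫ z, R z ∂baseRounds T = 0 := by
      refine integral_eq_zero_of_swapAt l hRm fun z => ?_
      have e : lik G (J ∪ K) (swapAt l z) = lik G (J ∪ K) z :=
        lik_congr G fun k hk => swapAt_of_ne (fun h : k = l => hlJK (h ▸ hk)) z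
      simp only [hR, e, hK l (Finset.mem_insert_self _ _) z, swapAt_fst]
      rw [swapAt_self, rewardSign_swapRewards]
      ring
    have hRi : Integrable R (baseRounds T) := by
      refine integrable_of_forall_abs_le (C := C * 2 ^ (J ∪ K).card * 1) hRm fun z => ?_
      have h0 : 0 ≤ C := (abs_nonneg _).trans (hC z)
      simp only [hR]
      rw [abs_mul, abs_mul]
      exact mul_le_mul (mul_le_mul (hC z) (abs_lik_le hG1 _ z) (abs_nonneg _) h0)
        (abs_mul_rewardSign_le hG1 (z l)) (abs_nonneg _) (by positivity)
    have key : ∀ z, F z * lik G (J ∪ insert l K) z = F z * lik G (J ∪ K) z + R z := by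
      intro z
      have : lik G (J ∪ insert l K) z = roundLik G (z l) * lik G (J ∪ K) z := by
        rw [Finset.union_insert, lik, Finset.prod_insert hlJK]; rfl
      rw [this]
      simp only [hR, roundLik]
      ring
    simp only [key]
    rw [integral_add (integrable_mul_lik hG hG1 _ hF hC) hRi, hR0, add_zero]

theorem integral_lik {G : I → ℝ} (hG : Measurable G) (hG1 : ∀ x, |G x| ≤ 1)
    (J : Finset (Fin T)) : ∫ z, lik G J z ∂baseRounds T = 1 := by
  have h := integral_mul_lik_union hG hG1 (F := fun _ => 1) (C := 1) measurable_const (by simp)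
    ∅ J (by simp) (by simp)
  simpa [lik] using h

theorem one_add_pow_le {v : ℝ} (hv : 0 ≤ v) (n : ℕ) (h : n * v ≤ 1) :
    (1 + v) ^ n ≤ 1 + 2 * (n * v) := by
  have h1 : (1 + v) ^ n ≤ Real.exp (n * v) := by
    rw [Real.exp_nat_mul]
    exact pow_le_pow_left₀ (by linarith) (by linarith [Real.add_one_le_exp v]) n
  have h0 : 0 ≤ n * v := by positivity
  have h2 := Real.abs_exp_sub_one_le (x := n * v) (by rw [abs_of_nonneg h0]; exact h)
  rw [abs_of_nonneg h0] at h2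
  linarith [(abs_le.1 h2).2]

/-- Two gaps that differ by the sign of `φ` are hard to tell apart from `J.card` rounds if
`J.card * ∫ φ ^ 2` is small. -/
theorem integral_abs_lik_sub_le {R φ : I → ℝ} (hR : Measurable R) (hφ : Measurable φ)
    (hR1 : ∀ x, |R x| ≤ 1) (hφ1 : ∀ x, |φ x| ≤ 1) (hRφ : ∀ x, R x * φ x = 0)
    (J : Finset (Fin T)) {η : ℝ} (hη : 0 < η) (hη1 : η ≤ 1)
    (hv : 6 * (J.card * ∫ x, φ x ^ 2) ≤ η ^ 2) :
    ∫ z, |lik (fun x => R x + φ x) J z - lik (fun x => R x - φ x) J z| ∂baseRounds T ≤ η := by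
  set v := ∫ x, φ x ^ 2 with hvdef
  have hφn1 : ∀ x, |(-φ x)| ≤ 1 := fun x => by rw [abs_neg]; exact hφ1 x
  have hφn : Measurable fun x => -φ x := hφ.neg
  have hsq : ∀ x, φ x ^ 2 ≤ 1 := fun x => (sq_le_one_iff_abs_le_one _).2 (hφ1 x)
  have hsqi : Integrable (fun x : I => φ x ^ 2) volume :=
    integrable_of_forall_abs_le (C := 1) (hφ.pow_const 2) fun x => by
      rw [abs_of_nonneg (sq_nonneg _)]; exact hsq x
  have hv0 : 0 ≤ v := integral_nonneg fun x => sq_nonneg _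
  have hv1 : v ≤ 1 := by
    have := integral_mono hsqi (integrable_const (1 : ℝ)) hsq
    simpa using this
  have hA := measurable_lik (T := T) hR J
  -- Because `R * φ = 0`, the tilts factor: `(1 + R r) (1 + φ r) = 1 + (R + φ) r`.
  have e1 : ∀ z : Fin T → I × (Bool → I),
      lik (fun x => R x + φ x) J z = lik R J z * lik φ J z := by
    intro z
    rw [lik, lik, lik, ← Finset.prod_mul_distrib]
    refine Finset.prod_congr rfl fun k _ => ?_
    simp only [roundLik]
    linear_combination (-(rewardSign (z k)) ^ 2) * hRφ (z k).1
  have e2 : ∀ z : Fin T → I × (Bool → I),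
      lik (fun x => R x - φ x) J z = lik R J z * lik (fun x => -φ x) J z := by
    intro z
    rw [lik, lik, lik, ← Finset.prod_mul_distrib]
    refine Finset.prod_congr rfl fun k _ => ?_
    simp only [roundLik]
    linear_combination ((rewardSign (z k)) ^ 2) * hRφ (z k).1
  -- Second moments factor over rounds. Averaging the coin leaves only even powers of the reward
  -- sign.
  have prod_int : ∀ P Q : I → ℝ, Measurable P → Measurable Q → (∀ x, |P x| ≤ 1) →
      (∀ x, |Q x| ≤ 1) →
      Integrable (fun z => lik P J z * lik Q J z * lik R J z) (baseRounds T) ∧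
      ∫ z, lik P J z * lik Q J z * lik R J z ∂baseRounds T
        = (∫ x : I, (1 + P x * Q x + R x * P x + R x * Q x)) ^ J.card := by
    intro P Q hP hQ hP1 hQ1
    refine ⟨integrable_mul_lik hR hR1 J (C := 2 ^ J.card * 2 ^ J.card)
      ((measurable_lik hP J).mul (measurable_lik hQ J)) fun z => ?_, ?_⟩
    · rw [abs_mul]
      exact mul_le_mul (abs_lik_le hP1 J z) (abs_lik_le hQ1 J z) (abs_nonneg _) (by positivity)
    · have e : ∀ z : Fin T → I × (Bool → I), lik P J z * lik Q J z * lik R J z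
          = ∏ k ∈ J, (roundLik P (z k) * roundLik Q (z k) * roundLik R (z k)) := by
        intro z; simp only [lik, Finset.prod_mul_distrib]
      simp only [e]
      rw [integral_pi_prod baseLaw J fun a => roundLik P a * roundLik Q a * roundLik R a]
      congr 1
      have hm : Measurable fun a => roundLik P a * roundLik Q a * roundLik R a :=
        ((measurable_roundLik hP).mul (measurable_roundLik hQ)).mul (measurable_roundLik hR)
      rw [integral_baseLaw (C := 2 * 2 * 2) hm]
      · refine integral_congr_ae (Filter.Eventually.of_forall fun x => ?_)
        simp only [roundLik, rewardSign_winVec_true, rewardSign_winVec_false]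
        ring
      · intro z
        rw [abs_mul, abs_mul]
        have h1 := abs_roundLik_le_two hP1 z
        have h2 := abs_roundLik_le_two hQ1 z
        have h3 := abs_roundLik_le_two hR1 z
        gcongr
  obtain ⟨i1, j1⟩ := prod_int φ φ hφ hφ hφ1 hφ1
  obtain ⟨i2, j2⟩ := prod_int φ (fun x => -φ x) hφ hφn hφ1 hφn1
  obtain ⟨i3, j3⟩ := prod_int (fun x => -φ x) (fun x => -φ x) hφn hφn hφn1 hφn1
  have k1 : ∫ x : I, (1 + φ x * φ x + R x * φ x + R x * φ x) = 1 + v := by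
    simp only [hRφ, add_zero, ← pow_two]
    rw [integral_add (integrable_const _) hsqi]; simp [hvdef]
  have k2 : ∫ x : I, (1 + φ x * -φ x + R x * φ x + R x * -φ x) = 1 - v := by
    simp only [mul_neg, hRφ, add_zero, ← pow_two, neg_zero, ← sub_eq_add_neg]
    rw [integral_sub (integrable_const _) hsqi]; simp [hvdef]
  have k3 : ∫ x : I, (1 + -φ x * -φ x + R x * -φ x + R x * -φ x) = 1 + v := by
    simp only [mul_neg, hRφ, add_zero, ← pow_two, neg_zero, neg_sq]
    rw [integral_add (integrable_const _) hsqi]; simp [hvdef]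
  rw [k1] at j1; rw [k2] at j2; rw [k3] at j3
  have i0 : Integrable (fun z => lik R J z) (baseRounds T) :=
    integrable_of_forall_abs_le hA (abs_lik_le hR1 J)
  have j0 := integral_lik (T := T) hR hR1 J
  have hbound : ∀ z : Fin T → I × (Bool → I),
      |lik (fun x => R x + φ x) J z - lik (fun x => R x - φ x) J z|
        ≤ (η / 2) * lik R J z + (2 * η)⁻¹ * (lik φ J z * lik φ J z * lik R J z
          - 2 * (lik φ J z * lik (fun x => -φ x) J z * lik R J z)
          + lik (fun x => -φ x) J z * lik (fun x => -φ x) J z * lik R J z) := by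
    intro z
    rw [e1, e2, ← mul_sub, abs_mul, abs_of_nonneg (lik_nonneg hR1 J z)]
    set a := lik R J z with ha
    set d := lik φ J z - lik (fun x => -φ x) J z with hd
    have ha0 : 0 ≤ a := lik_nonneg hR1 J z
    -- The inequality between arithmetic and geometric means replaces Cauchy–Schwarz in passing from
    -- the absolute to the second moment, weighted by the common factor `a`.
    have h1 : |d| ≤ η / 2 + (2 * η)⁻¹ * d ^ 2 := by
      have h2 : η / 2 + (2 * η)⁻¹ * d ^ 2 - |d| = (2 * η)⁻¹ * (|d| - η) ^ 2 := by
        rw [← sq_abs d]; field_simp; ring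
      have : 0 ≤ (2 * η)⁻¹ * (|d| - η) ^ 2 := by positivity
      linarith
    calc a * |d| ≤ a * (η / 2 + (2 * η)⁻¹ * d ^ 2) := mul_le_mul_of_nonneg_left h1 ha0
      _ = _ := by rw [hd]; ring
  have i12 : Integrable (fun z => lik φ J z * lik φ J z * lik R J z
      - 2 * (lik φ J z * lik (fun x => -φ x) J z * lik R J z)) (baseRounds T) :=
    i1.sub (i2.const_mul 2)
  have i123 : Integrable (fun z => lik φ J z * lik φ J z * lik R J z
      - 2 * (lik φ J z * lik (fun x => -φ x) J z * lik R J z)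
      + lik (fun x => -φ x) J z * lik (fun x => -φ x) J z * lik R J z) (baseRounds T) :=
    i12.add i3
  have hint : Integrable (fun z => (η / 2) * lik R J z + (2 * η)⁻¹ *
      (lik φ J z * lik φ J z * lik R J z
          - 2 * (lik φ J z * lik (fun x => -φ x) J z * lik R J z)
          + lik (fun x => -φ x) J z * lik (fun x => -φ x) J z * lik R J z)) (baseRounds T) :=
    (i0.const_mul _).add (i123.const_mul _)
  have hle := integral_mono_of_nonneg (μ := baseRounds T)
    (Filter.Eventually.of_forall fun z => abs_nonneg _) hint
    (Filter.Eventually.of_forall hbound)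
  refine hle.trans ?_
  rw [integral_add (i0.const_mul _) (i123.const_mul _),
    integral_const_mul, integral_const_mul, integral_add i12 i3,
    integral_sub i1 (i2.const_mul 2), integral_const_mul, j0, j1, j2, j3]
  have hnv : (J.card : ℝ) * v ≤ 1 := by nlinarith
  have p1 := one_add_pow_le hv0 J.card hnv
  have p2 : 1 - J.card * v ≤ (1 - v) ^ J.card := by
    have := one_add_mul_le_pow (a := -v) (by linarith) J.card
    rw [← sub_eq_add_neg] at this
    linarith
  -- The left side is at most `2 (1 + 2 n v) - 2 (1 - n v) = 6 n v` with `n = J.card`, whence the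
  -- constant `6` in the hypothesis.
  have hfin : (1 + v) ^ J.card - 2 * (1 - v) ^ J.card + (1 + v) ^ J.card ≤ η ^ 2 := by linarith
  have hη' : (0 : ℝ) ≤ (2 * η)⁻¹ := by positivity
  calc η / 2 * 1 + (2 * η)⁻¹ * ((1 + v) ^ J.card - 2 * (1 - v) ^ J.card + (1 + v) ^ J.card)
      ≤ η / 2 * 1 + (2 * η)⁻¹ * η ^ 2 := by gcongr
    _ = η := by field_simp; norm_num

end Likelihood

/-! ### Hypercubes of gaps -/

/-- Finitely many nonnegative functions with disjoint supports. -/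
structure BumpFamily (ι : Type*) where
  bump : ι → I → ℝ
  measurable_bump : ∀ b, Measurable (bump b)
  nonneg : ∀ b x, 0 ≤ bump b x
  le_one : ∀ b x, bump b x ≤ 1
  mul_eq_zero : ∀ b b', b ≠ b' → ∀ x, bump b x * bump b' x = 0

namespace BumpFamily

variable {ι : Type*} (Φ : BumpFamily ι)

/-- Disjoint supports leave at most one nonzero bump at each point; pointwise facts about the sums
over bumps reduce to these two cases. -/
theorem exists_active (x : I) :
    (∀ b, Φ.bump b x = 0) ∨ ∃ b, Φ.bump b x ≠ 0 ∧ ∀ b', b' ≠ b → Φ.bump b' x = 0 := by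
  by_cases h : ∀ b, Φ.bump b x = 0
  · exact Or.inl h
  · push Not at h
    obtain ⟨b, hb⟩ := h
    exact Or.inr ⟨b, hb, fun b' hb' =>
      (_root_.mul_eq_zero.1 (Φ.mul_eq_zero b' b hb' x)).resolve_right hb⟩

theorem abs_bump_le_one (b : ι) (x : I) : |Φ.bump b x| ≤ 1 := by
  rw [abs_of_nonneg (Φ.nonneg b x)]; exact Φ.le_one b x

/-- The indicator of pulling the arm `a` when the better arm on bump `b` is the other one. -/
def wrongArm (s : ι → Bool) (b : ι) (a : Bool) : ℝ := if a = s b then 0 else 1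

theorem wrongArm_nonneg (s : ι → Bool) (b : ι) (a : Bool) : 0 ≤ wrongArm s b a := by
  unfold wrongArm; split_ifs <;> norm_num

theorem wrongArm_le_one (s : ι → Bool) (b : ι) (a : Bool) : wrongArm s b a ≤ 1 := by
  unfold wrongArm; split_ifs <;> norm_num

/-- Flipping the sign of one bump. -/
def flipSign [DecidableEq ι] (b : ι) : (ι → Bool) ≃ (ι → Bool) where
  toFun s := Function.update s b (!s b)
  invFun s := Function.update s b (!s b)
  left_inv s := by simp
  right_inv s := by simp

/-- Whatever arm is pulled, it is wrong for exactly one of the two signs of the bump. -/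
theorem wrongArm_flipSign [DecidableEq ι] (s : ι → Bool) (b : ι) (a : Bool) :
    wrongArm (flipSign b s) b a = 1 - wrongArm s b a := by
  simp only [wrongArm, flipSign, Equiv.coe_fn_mk, Function.update_self]
  cases a <;> cases s b <;> simp

theorem integral_bump_baseLaw (b : ι) : ∫ z, Φ.bump b z.1 ∂baseLaw = ∫ x, Φ.bump b x := by
  have hm : Measurable fun z : I × (Bool → I) => Φ.bump b z.1 :=
    (Φ.measurable_bump b).comp measurable_fst
  rw [integral_baseLaw hm (C := 1) fun z => Φ.abs_bump_le_one b z.1]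
  simp

variable [Fintype ι]

/-- The gap whose sign on the support of bump `b` is given by `s b`. -/
def gap (s : ι → Bool) (x : I) : ℝ := ∑ b, if s b then Φ.bump b x else -Φ.bump b x

theorem measurable_gap (s : ι → Bool) : Measurable (Φ.gap s) := by
  refine Finset.measurable_sum _ fun b _ => ?_
  cases s b
  · simpa only [Bool.false_eq_true, if_false] using! (Φ.measurable_bump b).neg
  · simpa using Φ.measurable_bump b

theorem gap_eq_zero (s : ι → Bool) {x : I} (h : ∀ b, Φ.bump b x = 0) : Φ.gap s x = 0 :=
  Finset.sum_eq_zero fun b _ => by simp [h b]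

theorem gap_eq_active (s : ι → Bool) {x : I} {b : ι} (h : ∀ b', b' ≠ b → Φ.bump b' x = 0) :
    Φ.gap s x = if s b then Φ.bump b x else -Φ.bump b x :=
  Finset.sum_eq_single b (fun b' _ hb' => by simp [h b' hb']) (by simp)

theorem abs_gap_eq_sum (s : ι → Bool) (x : I) : |Φ.gap s x| = ∑ b, Φ.bump b x := by
  rcases Φ.exists_active x with h | ⟨b, -, h⟩
  · rw [Φ.gap_eq_zero s h, abs_zero, Finset.sum_eq_zero fun b _ => h b]
  · rw [Φ.gap_eq_active s h, Finset.sum_eq_single b (fun b' _ hb' => h b' hb') (by simp)]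
    split_ifs
    · exact abs_of_nonneg (Φ.nonneg b x)
    · rw [abs_neg, abs_of_nonneg (Φ.nonneg b x)]

theorem abs_gap_le_one (s : ι → Bool) (x : I) : |Φ.gap s x| ≤ 1 := by
  rw [abs_gap_eq_sum]
  rcases Φ.exists_active x with h | ⟨b, -, h⟩
  · rw [Finset.sum_eq_zero fun b _ => h b]; norm_num
  · rw [Finset.sum_eq_single b (fun b' _ hb' => h b' hb') (by simp)]
    exact Φ.le_one b x

variable [DecidableEq ι]

/-- The part of the gap which does not depend on the sign of bump `b`. -/
def gapWithout (s : ι → Bool) (b : ι) (x : I) : ℝ :=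
  ∑ b' ∈ Finset.univ.erase b, if s b' then Φ.bump b' x else -Φ.bump b' x

theorem measurable_gapWithout (s : ι → Bool) (b : ι) : Measurable (Φ.gapWithout s b) := by
  refine Finset.measurable_sum _ fun b _ => ?_
  cases s b
  · simpa only [Bool.false_eq_true, if_false] using! (Φ.measurable_bump b).neg
  · simpa using Φ.measurable_bump b

theorem gap_eq_add (s : ι → Bool) (b : ι) (x : I) :
    Φ.gap s x = Φ.gapWithout s b x + if s b then Φ.bump b x else -Φ.bump b x := by
  rw [gap, gapWithout, Finset.sum_erase_add _ _ (Finset.mem_univ b)]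

theorem gapWithout_mul_bump (s : ι → Bool) (b : ι) (x : I) :
    Φ.gapWithout s b x * Φ.bump b x = 0 := by
  rw [gapWithout, Finset.sum_mul]
  refine Finset.sum_eq_zero fun b' hb' => ?_
  have h := Φ.mul_eq_zero b' b (Finset.ne_of_mem_erase hb') x
  split_ifs
  · exact h
  · rw [neg_mul, h, neg_zero]

theorem abs_gapWithout_le_one (s : ι → Bool) (b : ι) (x : I) : |Φ.gapWithout s b x| ≤ 1 := by
  rcases _root_.mul_eq_zero.1 (Φ.gapWithout_mul_bump s b x) with h | h
  · rw [h]; norm_num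
  · have := Φ.gap_eq_add s b x
    rw [h] at this
    simp only [neg_zero, ite_self, add_zero] at this
    rw [← this]; exact Φ.abs_gap_le_one s x

theorem gapWithout_update (s : ι → Bool) (b : ι) (v : Bool) :
    Φ.gapWithout (Function.update s b v) b = Φ.gapWithout s b := by
  funext x
  refine Finset.sum_congr rfl fun b' hb' => ?_
  rw [Function.update_of_ne (Finset.ne_of_mem_erase hb')]

variable {T : ℕ}

/-- The other bumps vanish wherever bump `b` does not, so `gapWithout` plays the role of `R` in
`integral_abs_lik_sub_le`. -/
theorem integral_abs_lik_flipSign_le (s : ι → Bool) (b : ι) (J : Finset (Fin T)) {η : ℝ}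
    (hη : 0 < η) (hη1 : η ≤ 1) (hv : 6 * (J.card * ∫ x, Φ.bump b x ^ 2) ≤ η ^ 2) :
    ∫ z, |lik (Φ.gap s) J z - lik (Φ.gap (flipSign b s)) J z| ∂baseRounds T ≤ η := by
  have key := integral_abs_lik_sub_le (T := T) (Φ.measurable_gapWithout s b) (Φ.measurable_bump b)
    (Φ.abs_gapWithout_le_one s b) (Φ.abs_bump_le_one b) (Φ.gapWithout_mul_bump s b) J hη hη1 hv
  have e1 : Φ.gap s = fun x => Φ.gapWithout s b x + if s b then Φ.bump b x else -Φ.bump b x :=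
    funext fun x => Φ.gap_eq_add s b x
  have e2 : Φ.gap (flipSign b s)
      = fun x => Φ.gapWithout s b x + if s b then -Φ.bump b x else Φ.bump b x := by
    funext x
    rw [Φ.gap_eq_add _ b x]
    simp only [flipSign, Equiv.coe_fn_mk, gapWithout_update, Function.update_self]
    cases s b <;> simp
  rw [e1, e2]
  cases s b
  · simp only [Bool.false_eq_true, if_false, ← sub_eq_add_neg]
    simp only [abs_sub_comm (lik (fun x => Φ.gapWithout s b x - Φ.bump b x) J _)]
    exact key
  · simpa only [if_true, ← sub_eq_add_neg] using key

/-- On an event that is determined by the first `n` rounds, and on which the arm pulled in a later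
round `k` depends on the rewards of the first `n` rounds only, the sign of a bump that cannot be
detected in `n` rounds is guessed wrongly with constant probability, on average over the
hypercube. -/
theorem sum_integral_wrongArm_ge (b : ι) {n : ℕ} {k : Fin T} (hk : n ≤ (k : ℕ))
    {E : Set (Fin T → I × (Bool → I))} (hE : MeasurableSet E)
    (hEn : ∀ z z', (∀ l : Fin T, (l : ℕ) < n → z l = z' l) → z ∈ E → z' ∈ E)
    {g : (Fin T → I × (Bool → I)) → Bool} (hg : Measurable g)
    (hgE : ∀ z z', z ∈ E → (∀ l, (z l).1 = (z' l).1) →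
      (∀ l : Fin T, (l : ℕ) < n → z l = z' l) → g z = g z')
    {η : ℝ} (hη : 0 < η) (hη1 : η ≤ 1) (hv : 6 * (n * ∫ x, Φ.bump b x ^ 2) ≤ η ^ 2) :
    (∫ x, Φ.bump b x) / 2 *
        (∑ s, ∫ z, E.indicator 1 z * lik (Φ.gap s) Finset.univ z ∂baseRounds T
          - 2 ^ Fintype.card ι * (η / 2))
      ≤ ∑ s, ∫ z, (E.indicator 1 z * (Φ.bump b (z k).1 * wrongArm s b (g z)))
          * lik (Φ.gap s) Finset.univ z ∂baseRounds T := by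
  classical
  set J : Finset (Fin T) := Finset.univ.filter fun l => (l : ℕ) < n with hJ
  have hkJ : k ∉ J := by simp [hJ, hk]
  have hJcard : (J.card : ℝ) ≤ n := by
    have : J.card ≤ (Finset.range n).card :=
      Finset.card_le_card_of_injOn (fun l : Fin T => (l : ℕ))
        (fun l hl => by simpa [hJ] using hl) fun a _ b _ h => Fin.ext h
    rw [Finset.card_range] at this
    exact_mod_cast this
  have hsq0 : 0 ≤ ∫ x, Φ.bump b x ^ 2 := integral_nonneg fun x => sq_nonneg _
  have hvJ : 6 * (J.card * ∫ x, Φ.bump b x ^ 2) ≤ η ^ 2 := by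
    refine le_trans ?_ hv
    gcongr
  have hφm : Measurable fun z : Fin T → I × (Bool → I) => Φ.bump b (z k).1 :=
    (Φ.measurable_bump b).comp (measurable_fst.comp (measurable_pi_apply k))
  have h1E : Measurable (E.indicator (1 : (Fin T → I × (Bool → I)) → ℝ)) :=
    measurable_one.indicator hE
  have h1E0 : ∀ z, 0 ≤ E.indicator (1 : (Fin T → I × (Bool → I)) → ℝ) z := fun z =>
    Set.indicator_nonneg (fun _ _ => zero_le_one) z
  have h1E1 : ∀ z, E.indicator (1 : (Fin T → I × (Bool → I)) → ℝ) z ≤ 1 := fun z =>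
    Set.indicator_le_self' (fun _ _ => zero_le_one) z
  have h1Ec : ∀ z z', (∀ l : Fin T, (l : ℕ) < n → z l = z' l) →
      E.indicator (1 : (Fin T → I × (Bool → I)) → ℝ) z = E.indicator 1 z' := by
    intro z z' h
    by_cases hz : z ∈ E
    · rw [Set.indicator_of_mem hz, Set.indicator_of_mem (hEn z z' h hz)]; rfl
    · rw [Set.indicator_of_notMem hz, Set.indicator_of_notMem fun hz' =>
        hz (hEn z' z (fun l hl => (h l hl).symm) hz')]
  have hw : ∀ s : ι → Bool, Measurable fun z => wrongArm s b (g z) := fun s =>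
    (measurable_of_finite (wrongArm s b)).comp hg
  have hFm : ∀ s : ι → Bool, Measurable fun z : Fin T → I × (Bool → I) =>
      E.indicator 1 z * (Φ.bump b (z k).1 * wrongArm s b (g z)) := fun s =>
    h1E.mul (hφm.mul (hw s))
  have hFb : ∀ (s : ι → Bool) (z : Fin T → I × (Bool → I)),
      |E.indicator 1 z * (Φ.bump b (z k).1 * wrongArm s b (g z))| ≤ 1 := by
    intro s z
    have p1 := wrongArm_nonneg s b (g z)
    have p2 := Φ.nonneg b (z k).1
    rw [abs_of_nonneg (mul_nonneg (h1E0 z) (mul_nonneg p2 p1))]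
    exact mul_le_one₀ (h1E1 z) (mul_nonneg p2 p1)
      (mul_le_one₀ (Φ.le_one _ _) p1 (wrongArm_le_one _ _ _))
  have h1Eb : ∀ z : Fin T → I × (Bool → I),
      |E.indicator (1 : (Fin T → I × (Bool → I)) → ℝ) z| ≤ 1 := fun z => by
    rw [abs_of_nonneg (h1E0 z)]; exact h1E1 z
  have hswap : ∀ l ∈ Jᶜ, ∀ (z : Fin T → I × (Bool → I)) (i : Fin T), (i : ℕ) < n →
      swapAt l z i = z i := by
    intro l hl z i hi
    refine swapAt_of_ne (fun h => ?_) z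
    simp [hJ] at hl
    subst h; omega
  have huniv : J ∪ Jᶜ = Finset.univ := Finset.union_compl J
  -- On `E` the pull in round `k` ignores the rewards from round `n` on, and off `E` the integrand
  -- vanishes, so only the likelihood of the rounds in `J` matters.
  have redF : ∀ s : ι → Bool,
      ∫ z, (E.indicator 1 z * (Φ.bump b (z k).1 * wrongArm s b (g z)))
          * lik (Φ.gap s) Finset.univ z ∂baseRounds T
        = ∫ z, (E.indicator 1 z * (Φ.bump b (z k).1 * wrongArm s b (g z)))
          * lik (Φ.gap s) J z ∂baseRounds T := by
    intro s
    rw [← huniv]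
    refine integral_mul_lik_union (Φ.measurable_gap s) (Φ.abs_gap_le_one s) (hFm s) (hFb s) J Jᶜ
      disjoint_compl_right fun l hl z => ?_
    rw [swapAt_fst, h1Ec _ z (hswap l hl z)]
    by_cases hz : z ∈ E
    · rw [hgE z (swapAt l z) hz (fun i => (swapAt_fst l i z).symm)
        fun i hi => (hswap l hl z i hi).symm]
    · rw [Set.indicator_of_notMem hz]; simp
  have redE : ∀ s : ι → Bool,
      ∫ z, E.indicator 1 z * lik (Φ.gap s) Finset.univ z ∂baseRounds T
        = ∫ z, E.indicator 1 z * lik (Φ.gap s) J z ∂baseRounds T := by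
    intro s
    rw [← huniv]
    exact integral_mul_lik_union (Φ.measurable_gap s) (Φ.abs_gap_le_one s) h1E h1Eb J Jᶜ
      disjoint_compl_right fun l hl z => h1Ec _ z (hswap l hl z)
  simp only [redF, redE]
  set F : (ι → Bool) → ℝ := fun s =>
    ∫ z, (E.indicator 1 z * (Φ.bump b (z k).1 * wrongArm s b (g z))) * lik (Φ.gap s) J z
      ∂baseRounds T with hF
  set P : (ι → Bool) → ℝ := fun s =>
    ∫ z, E.indicator 1 z * lik (Φ.gap s) J z ∂baseRounds T with hP
  set m := ∫ x, Φ.bump b x with hm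
  have hm0 : 0 ≤ m := integral_nonneg fun x => Φ.nonneg b x
  have upd : ∀ (z : Fin T → I × (Bool → I)) (a : I × (Bool → I)) (l : Fin T), l ∈ J →
      Function.update z k a l = z l := fun z a l hl =>
    Function.update_of_ne (fun h : l = k => hkJ (h ▸ hl)) _ _
  have memJ : ∀ l : Fin T, (l : ℕ) < n → l ∈ J := fun l hl => by simpa [hJ] using hl
  -- Round `k` is not in `J`, so its context is independent of the event and of the likelihood. The
  -- pull itself may depend on that context; it has to be eliminated first, as in `pair`.
  have indep : ∀ s, ∫ z, Φ.bump b (z k).1 * (E.indicator 1 z * lik (Φ.gap s) J z) ∂baseRounds T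
      = m * P s := by
    intro s
    rw [hm, ← Φ.integral_bump_baseLaw b]
    exact integral_pi_mul_of_update baseLaw k ((Φ.measurable_bump b).comp measurable_fst)
      (h1E.mul (measurable_lik (Φ.measurable_gap s) J)) fun z a => by
        rw [h1Ec (Function.update z k a) z fun l hl => upd z a l (memJ l hl),
          lik_congr _ (upd z a)]
  have intF : ∀ s, Integrable (fun z => (E.indicator 1 z *
      (Φ.bump b (z k).1 * wrongArm s b (g z))) * lik (Φ.gap s) J z) (baseRounds T) := fun s =>
    integrable_mul_lik (Φ.measurable_gap s) (Φ.abs_gap_le_one s) J (hFm s) (hFb s)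
  have intP : ∀ s, Integrable (fun z => Φ.bump b (z k).1 *
      (E.indicator 1 z * lik (Φ.gap s) J z)) (baseRounds T) := by
    intro s
    have := integrable_mul_lik (Φ.measurable_gap s) (Φ.abs_gap_le_one s) J (C := 1)
      (F := fun z => Φ.bump b (z k).1 * E.indicator 1 z) (hφm.mul h1E) fun z => by
        rw [abs_mul]
        exact mul_le_one₀ (Φ.abs_bump_le_one _ _) (abs_nonneg _) (h1Eb z)
    simpa only [mul_assoc] using this
  have dm : ∀ s, Measurable fun z : Fin T → I × (Bool → I) =>
      |lik (Φ.gap s) J z - lik (Φ.gap (flipSign b s)) J z| := fun s =>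
    ((measurable_lik (Φ.measurable_gap s) J).sub
      (measurable_lik (Φ.measurable_gap (flipSign b s)) J)).abs
  have intD : ∀ s, Integrable (fun z => Φ.bump b (z k).1 *
      |lik (Φ.gap s) J z - lik (Φ.gap (flipSign b s)) J z|) (baseRounds T) := by
    intro s
    refine integrable_of_forall_abs_le (C := 1 * (2 ^ J.card + 2 ^ J.card)) (hφm.mul (dm s))
      fun z => ?_
    rw [abs_mul, abs_abs]
    exact mul_le_mul (Φ.abs_bump_le_one _ _) ((abs_sub _ _).trans (add_le_add
      (abs_lik_le (Φ.abs_gap_le_one s) J z)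
      (abs_lik_le (Φ.abs_gap_le_one (flipSign b s)) J z))) (abs_nonneg _) zero_le_one
  have indepD : ∀ s, ∫ z, Φ.bump b (z k).1 *
      |lik (Φ.gap s) J z - lik (Φ.gap (flipSign b s)) J z| ∂baseRounds T ≤ m * η := by
    intro s
    have := integral_pi_mul_of_update baseLaw k ((Φ.measurable_bump b).comp measurable_fst)
      (dm s) fun z a => by rw [lik_congr _ (upd z a), lik_congr _ (upd z a)]
    simp only [Function.comp_apply] at this
    rw [this, Φ.integral_bump_baseLaw b]
    exact mul_le_mul_of_nonneg_left (Φ.integral_abs_lik_flipSign_le s b J hη hη1 hvJ) hm0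
  have pair : ∀ s, m * (P s / 2 + P (flipSign b s) / 2 - η / 2) ≤ F s + F (flipSign b s) := by
    intro s
    -- The wrong-arm weights of `s` and of its flip add up to `1`, so on `E` the right side is at
    -- least the bump times the smaller likelihood, and `min A B = (A + B - |A - B|) / 2`.
    have pw : ∀ z : Fin T → I × (Bool → I),
        (Φ.bump b (z k).1 * (E.indicator 1 z * lik (Φ.gap s) J z)) / 2
          + (Φ.bump b (z k).1 * (E.indicator 1 z * lik (Φ.gap (flipSign b s)) J z)) / 2
          - (Φ.bump b (z k).1 * |lik (Φ.gap s) J z - lik (Φ.gap (flipSign b s)) J z|) / 2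
        ≤ (E.indicator 1 z * (Φ.bump b (z k).1 * wrongArm s b (g z))) * lik (Φ.gap s) J z
          + (E.indicator 1 z * (Φ.bump b (z k).1 * wrongArm (flipSign b s) b (g z)))
            * lik (Φ.gap (flipSign b s)) J z := by
      intro z
      rw [wrongArm_flipSign]
      set A := lik (Φ.gap s) J z
      set B := lik (Φ.gap (flipSign b s)) J z
      have hφ0 := Φ.nonneg b (z k).1
      have hD := mul_nonneg hφ0 (sub_nonneg.2 (le_abs_self (A - B)))
      have hD' := mul_nonneg hφ0 (sub_nonneg.2 (neg_le_abs (A - B)))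
      have hD0 := mul_nonneg hφ0 (abs_nonneg (A - B))
      by_cases hz : z ∈ E
      · rw [Set.indicator_of_mem hz]
        simp only [Pi.one_apply]
        have hw01 : wrongArm s b (g z) = 0 ∨ wrongArm s b (g z) = 1 := by
          unfold wrongArm; split_ifs <;> simp
        rcases hw01 with h | h <;> rw [h] <;> nlinarith
      · rw [Set.indicator_of_notMem hz]
        nlinarith
    have i1 := (intP s).div_const 2
    have i2 := (intP (flipSign b s)).div_const 2
    have i3 := (intD s).div_const 2
    have i12 : Integrable (fun z => (Φ.bump b (z k).1 * (E.indicator 1 z * lik (Φ.gap s) J z)) / 2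
          + (Φ.bump b (z k).1 * (E.indicator 1 z * lik (Φ.gap (flipSign b s)) J z)) / 2)
        (baseRounds T) := i1.add i2
    have h := integral_mono (i12.sub i3) ((intF s).add (intF (flipSign b s))) pw
    simp only [Pi.add_apply, Pi.sub_apply] at h
    rw [integral_sub i12 i3, integral_add i1 i2, integral_add (intF s) (intF _),
      integral_div, integral_div, integral_div, indep, indep] at h
    have := indepD s
    simp only [hF]
    linarith
  -- Flipping is a bijection of the hypercube, so summing the bounds for pairs counts every vertex
  -- twice.
  have sumF : ∑ s, F (flipSign b s) = ∑ s, F s := Equiv.sum_comp (flipSign b) F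
  have sumP : ∑ s, P (flipSign b s) = ∑ s, P s := Equiv.sum_comp (flipSign b) P
  have total := Finset.sum_le_sum fun s (_ : s ∈ Finset.univ) => pair s
  rw [Finset.sum_add_distrib, sumF, ← Finset.mul_sum, Finset.sum_sub_distrib,
    Finset.sum_add_distrib, ← Finset.sum_div, ← Finset.sum_div, sumP, Finset.sum_const,
    Finset.card_univ, Fintype.card_fun, Fintype.card_bool, nsmul_eq_mul] at total
  push_cast at total
  linarith

end BumpFamily

/-! ### Causality and regret of batched policies -/

namespace BatchedPolicy

variable {T M : ℕ} {S : Type*} [MeasurableSpace S] (π : BatchedPolicy T M S)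

theorem grid_mono (u : S) (x y : Fin T → I) {i j : ℕ} (hij : i ≤ j) (hj : j ≤ M) :
    π.grid u x y i ≤ π.grid u x y j := by
  induction j, hij using Nat.le_induction with
  | base => exact le_rfl
  | succ j _ ih => exact (ih (by omega)).trans (π.grid_lt u x y j (by omega)).le

theorem exists_batch (u : S) (x y : Fin T → I) (k : Fin T) :
    ∃ i < M, π.grid u x y i ≤ (k : ℕ) ∧ (k : ℕ) < π.grid u x y (i + 1) := by
  have key : ∀ n, n ≤ M → (k : ℕ) < π.grid u x y n →
      ∃ i < n, π.grid u x y i ≤ (k : ℕ) ∧ (k : ℕ) < π.grid u x y (i + 1) := by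
    intro n
    induction n with
    | zero => intro _ hk; rw [π.grid_zero] at hk; omega
    | succ n ih =>
      intro hn hk
      by_cases hk' : (k : ℕ) < π.grid u x y n
      · obtain ⟨i, hi, h1⟩ := ih (by omega) hk'
        exact ⟨i, by omega, h1⟩
      · exact ⟨n, by omega, by omega, hk⟩
  exact key M le_rfl (by rw [π.grid_last]; exact k.2)

/-- The arm in round `k` depends on the contexts up to round `k` and on earlier rewards only. -/
theorem act_congr_past (u : S) {x x' y y' : Fin T → I} {k : Fin T}
    (hx : ∀ l : Fin T, l ≤ k → x l = x' l) (hy : ∀ l : Fin T, l < k → y l = y' l) :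
    π.act u x y k = π.act u x' y' k := by
  obtain ⟨i, hi, h1, h2⟩ := π.exists_batch u x y k
  exact π.act_causal u x y x' y' i hi k h1 h2 hx
    fun l hl => hy l (Fin.lt_def.2 (lt_of_lt_of_le hl h1))

theorem observed_congr (u : S) {z z' : Fin T → I × (Bool → I)} (k : Fin T)
    (h : ∀ l ≤ k, z l = z' l) : π.observed u z k = π.observed u z' k := by
  induction k using WellFoundedLT.induction with
  | ind k ih =>
    rw [observed_apply, observed_apply, h k le_rfl]
    refine congrArg _ (π.act_congr_past u (fun l hl => by rw [h l hl]) fun l hl => ?_)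
    exact ih l hl fun j hj => h j (hj.trans hl.le)

theorem action_congr (u : S) {z z' : Fin T → I × (Bool → I)} {k : Fin T}
    (hx : ∀ l, (z l).1 = (z' l).1) (h : ∀ l < k, z l = z' l) :
    π.action u z k = π.action u z' k :=
  π.act_congr_past u (fun l _ => hx l) fun l hl =>
    π.observed_congr u l fun j hj => h j (hj.trans_lt hl)

/-- The `i`-th grid point when the policy is run with seed `u` on the data `z`. -/
def gridAt (u : S) (z : Fin T → I × (Bool → I)) (i : ℕ) : ℕ :=
  π.grid u (fun k => (z k).1) (π.observed u z) i

theorem gridAt_succ_congr (u : S) {z z' : Fin T → I × (Bool → I)} {i n : ℕ} (hi : i < M)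
    (hn : π.gridAt u z i ≤ n) (h : ∀ l : Fin T, (l : ℕ) < n → z l = z' l) :
    π.gridAt u z (i + 1) = π.gridAt u z' (i + 1) :=
  π.grid_causal u _ _ _ _ i hi fun l hl =>
    have hln : (l : ℕ) < n := lt_of_lt_of_le hl hn
    ⟨congrArg Prod.fst (h l hln), π.observed_congr u l fun j hj =>
      h j (lt_of_le_of_lt (Fin.le_def.1 hj) hln)⟩

theorem gridAt_congr (u : S) {z z' : Fin T → I × (Bool → I)} {i n : ℕ} (hi : i ≤ M)
    (hn : π.gridAt u z i ≤ n) (h : ∀ l : Fin T, (l : ℕ) < n → z l = z' l) :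
    π.gridAt u z i = π.gridAt u z' i := by
  cases i with
  | zero => simp only [gridAt, π.grid_zero]
  | succ i =>
    exact π.gridAt_succ_congr u (by omega) ((π.grid_mono u _ _ (Nat.le_succ i) hi).trans hn) h

/-- The event that batch `i + 1` starts by time `n` and ends after time `N`. -/
def longBatch (u : S) (i n N : ℕ) : Set (Fin T → I × (Bool → I)) :=
  {z | π.gridAt u z i ≤ n ∧ N < π.gridAt u z (i + 1)}

/-- A grid point that is at most `n` is computed from data before `n`, and the next one uses nothing
beyond it. Hence the event is decided by the first `n` rounds, although it speaks about the later
time `N`. -/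
theorem longBatch_congr (u : S) {i n N : ℕ} (hi : i < M) {z z' : Fin T → I × (Bool → I)}
    (h : ∀ l : Fin T, (l : ℕ) < n → z l = z' l) (hz : z ∈ π.longBatch u i n N) :
    z' ∈ π.longBatch u i n N := by
  obtain ⟨h1, h2⟩ := hz
  exact ⟨π.gridAt_congr u hi.le h1 h ▸ h1, π.gridAt_succ_congr u hi h1 h ▸ h2⟩

/-- Rounds from `n` up to `N` all lie in one batch, which started by time `n`; its pulls see no
later rewards. -/
theorem action_congr_longBatch (u : S) {i n N : ℕ} (hi : i < M) {z z' : Fin T → I × (Bool → I)}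
    (hz : z ∈ π.longBatch u i n N) {k : Fin T} (hnk : n ≤ (k : ℕ)) (hkN : (k : ℕ) < N)
    (hx : ∀ l, (z l).1 = (z' l).1) (h : ∀ l : Fin T, (l : ℕ) < n → z l = z' l) :
    π.action u z k = π.action u z' k :=
  π.act_causal u _ _ _ _ i hi k (hz.1.trans hnk) (hkN.trans hz.2) (fun l _ => hx l) fun l hl =>
    π.observed_congr u l fun j hj => h j (lt_of_le_of_lt (Fin.le_def.1 hj) (lt_of_lt_of_le hl hz.1))

/-- If no batch were long, induction would keep the `i`-th grid point below `τ i`, yet the last one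
is `T > τ M`. -/
theorem exists_mem_longBatch (u : S) (z : Fin T → I × (Bool → I)) {τ : ℕ → ℕ}
    (hM : τ M < T) : ∃ i ∈ Finset.range M, z ∈ π.longBatch u i (τ i) (τ (i + 1)) := by
  by_contra hcon
  push Not at hcon
  have : ∀ i, i ≤ M → π.gridAt u z i ≤ τ i := by
    intro i
    induction i with
    | zero => intro _; simp [gridAt, π.grid_zero]
    | succ i ih =>
      intro hi
      by_contra hlt
      exact hcon i (Finset.mem_range.2 hi) ⟨ih (by omega), not_le.1 hlt⟩
  have h := this M le_rfl
  rw [gridAt, π.grid_last] at h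
  omega

theorem measurable_observed :
    Measurable fun p : S × (Fin T → I × (Bool → I)) => π.observed p.1 p.2 := by
  have key : ∀ n : ℕ, Measurable fun p : S × (Fin T → I × (Bool → I)) =>
      ((fun (y : Fin T → I) (k : Fin T) =>
        (p.2 k).2 (π.act p.1 (fun j => (p.2 j).1) y k))^[n] fun _ => 0) := by
    intro n
    induction n with
    | zero => exact measurable_const
    | succ n ih =>
      simp only [Function.iterate_succ_apply']
      refine measurable_pi_iff.2 fun k => ?_
      have ha := (π.measurable_act k).comp (measurable_fst.prodMk
        ((show Measurable fun p : S × (Fin T → I × (Bool → I)) => fun j => (p.2 j).1 by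
          fun_prop).prodMk ih))
      have hev : Measurable fun q : (Bool → I) × Bool => q.1 q.2 :=
        measurable_from_prod_countable_left fun b => measurable_pi_apply b
      exact hev.comp ((show Measurable fun p : S × (Fin T → I × (Bool → I)) => (p.2 k).2 by
        fun_prop).prodMk ha)
  exact key T

theorem measurable_action (k : Fin T) :
    Measurable fun p : S × (Fin T → I × (Bool → I)) => π.action p.1 p.2 k :=
  (π.measurable_act k).comp (measurable_fst.prodMk
    ((show Measurable fun p : S × (Fin T → I × (Bool → I)) => fun j => (p.2 j).1 by
      fun_prop).prodMk π.measurable_observed))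

theorem measurable_gridAt {i : ℕ} (hi : i ≤ M) :
    Measurable fun p : S × (Fin T → I × (Bool → I)) => π.gridAt p.1 p.2 i :=
  (π.measurable_grid i hi).comp (measurable_fst.prodMk
    ((show Measurable fun p : S × (Fin T → I × (Bool → I)) => fun j => (p.2 j).1 by
      fun_prop).prodMk π.measurable_observed))

theorem measurableSet_longBatch_prod {i : ℕ} (hi : i < M) (n N : ℕ) :
    MeasurableSet {p : S × (Fin T → I × (Bool → I)) | p.2 ∈ π.longBatch p.1 i n N} :=
  (measurableSet_le (π.measurable_gridAt hi.le) measurable_const).inter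
    (measurableSet_lt measurable_const (π.measurable_gridAt hi))

theorem measurableSet_longBatch (u : S) {i : ℕ} (hi : i < M) (n N : ℕ) :
    MeasurableSet (π.longBatch u i n N) :=
  measurable_prodMk_left (π.measurableSet_longBatch_prod hi n N)

end BatchedPolicy

/-! ### Regret averaged over a hypercube of gaps -/

/-- The regret of one pull of arm `a` at the context `x` when the gap is `G`. -/
noncomputable def roundLoss (G : I → ℝ) (a : Bool) (x : I) : ℝ :=
  if a then max (-G x) 0 else max (G x) 0

theorem max_gapMean_sub (G : I → ℝ) (a : Bool) (x : I) :
    max (gapMean G true x) (gapMean G false x) - gapMean G a x = roundLoss G a x := by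
  simp only [gapMean, roundLoss, if_true, Bool.false_eq_true, if_false]
  rcases le_total 0 (G x) with h | h
  · rw [max_eq_left (by linarith), max_eq_right (by linarith : -G x ≤ 0), max_eq_left h]
    cases a
    · simp; ring
    · simp
  · rw [max_eq_right (by linarith), max_eq_left (by linarith : 0 ≤ -G x), max_eq_right h]
    cases a
    · simp
    · simp; ring

theorem measurable_roundLoss {G : I → ℝ} (hG : Measurable G) :
    Measurable fun p : Bool × I => roundLoss G p.1 p.2 := by
  refine measurable_from_prod_countable_right fun a => ?_
  cases a
  · simpa [roundLoss] using hG.max measurable_const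
  · simpa [roundLoss] using hG.neg.max measurable_const

theorem roundLoss_nonneg (G : I → ℝ) (a : Bool) (x : I) : 0 ≤ roundLoss G a x := by
  unfold roundLoss; split_ifs <;> exact le_max_right _ _

theorem abs_roundLoss_le {G : I → ℝ} (hG1 : ∀ x, |G x| ≤ 1) (a : Bool) (x : I) :
    |roundLoss G a x| ≤ 1 := by
  have h := abs_le.1 (hG1 x)
  rw [abs_of_nonneg (roundLoss_nonneg G a x)]
  unfold roundLoss; split_ifs <;> exact max_le (by linarith) zero_le_one

/-- The regret splits over bumps, so each bump can be treated as a separate testing problem. -/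
theorem BumpFamily.roundLoss_gap {ι : Type*} [Fintype ι] (Φ : BumpFamily ι) (s : ι → Bool)
    (a : Bool) (x : I) :
    roundLoss (Φ.gap s) a x = ∑ b, Φ.bump b x * BumpFamily.wrongArm s b a := by
  classical
  rcases Φ.exists_active x with h | ⟨b, -, h⟩
  · rw [roundLoss, Φ.gap_eq_zero s h, Finset.sum_eq_zero fun b _ => by rw [h b, zero_mul]]
    simp
  · rw [roundLoss, Φ.gap_eq_active s h,
      Finset.sum_eq_single b (fun b' _ hb' => by rw [h b' hb', zero_mul]) (by simp)]
    have := Φ.nonneg b x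
    cases a <;> cases hs : s b <;> simp [BumpFamily.wrongArm, hs, this]

namespace BatchedPolicy

variable {T M : ℕ} {S : Type*} [MeasurableSpace S] (π : BatchedPolicy T M S)

/-- The regret of a policy with seed `u` when the gap is `G`. -/
noncomputable def seedRegret (G : I → ℝ) (u : S) : ℝ :=
  ∫ z, (∑ k, roundLoss G (π.action u z k) (z k).1) * lik G Finset.univ z ∂baseRounds T

theorem measurable_roundLoss_action {G : I → ℝ} (hG : Measurable G) (k : Fin T) :
    Measurable fun p : S × (Fin T → I × (Bool → I)) =>
      roundLoss G (π.action p.1 p.2 k) (p.2 k).1 :=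
  (measurable_roundLoss hG).comp ((π.measurable_action k).prodMk
    (measurable_fst.comp ((measurable_pi_apply k).comp measurable_snd)))

theorem measurable_sum_roundLoss {G : I → ℝ} (hG : Measurable G) :
    Measurable fun p : S × (Fin T → I × (Bool → I)) =>
      ∑ k, roundLoss G (π.action p.1 p.2 k) (p.2 k).1 :=
  Finset.measurable_sum _ fun k _ => π.measurable_roundLoss_action hG k

theorem abs_sum_roundLoss_le {G : I → ℝ} (hG1 : ∀ x, |G x| ≤ 1)
    (p : S × (Fin T → I × (Bool → I))) :
    |∑ k, roundLoss G (π.action p.1 p.2 k) (p.2 k).1| ≤ T := by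
  refine (Finset.abs_sum_le_sum_abs _ _).trans ?_
  refine (Finset.sum_le_sum fun k _ => abs_roundLoss_le hG1 _ _).trans ?_
  simp

theorem integrable_mul_lik_prod (ν : Measure S) [IsProbabilityMeasure ν] {G : I → ℝ}
    (hG : Measurable G) (hG1 : ∀ x, |G x| ≤ 1) {F : S × (Fin T → I × (Bool → I)) → ℝ}
    (hF : Measurable F) {C : ℝ} (hC : ∀ p, |F p| ≤ C) :
    Integrable (fun u => ∫ z, F (u, z) * lik G Finset.univ z ∂baseRounds T) ν := by
  have : Integrable (fun p : S × (Fin T → I × (Bool → I)) => F p * lik G Finset.univ p.2)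
      (ν.prod (baseRounds T)) :=
    integrable_of_forall_abs_le (C := C * 2 ^ (Finset.univ : Finset (Fin T)).card)
      (hF.mul ((measurable_lik hG _).comp measurable_snd)) fun p => by
        rw [abs_mul]
        exact mul_le_mul (hC p) (abs_lik_le hG1 _ p.2) (abs_nonneg _) ((abs_nonneg _).trans (hC p))
  exact this.integral_prod_left

theorem integrable_seedRegret (ν : Measure S) [IsProbabilityMeasure ν] {G : I → ℝ}
    (hG : Measurable G) (hG1 : ∀ x, |G x| ≤ 1) : Integrable (π.seedRegret G) ν :=
  integrable_mul_lik_prod ν hG hG1 (π.measurable_sum_roundLoss hG) (π.abs_sum_roundLoss_le hG1)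

theorem regret_gapInstance (ν : Measure S) [IsProbabilityMeasure ν] {G : I → ℝ}
    (hG : Measurable G) (hG1 : ∀ x, |G x| ≤ 1) :
    π.regret ν (gapInstance G hG hG1) = ∫ u, π.seedRegret G u ∂ν := by
  have := isProbabilityMeasure_gapLaw hG hG1
  have e1 : π.regret ν (gapInstance G hG hG1) = ∫ p : S × (Fin T → I × (Bool → I)),
      ∑ k, roundLoss G (π.action p.1 p.2 k) (p.2 k).1
        ∂(ν.prod (Measure.pi fun _ : Fin T => gapLaw G)) := by
    simp only [← max_gapMean_sub]
    rfl
  rw [e1, integral_prod _ (integrable_of_forall_abs_le (π.measurable_sum_roundLoss hG)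
    (π.abs_sum_roundLoss_le hG1))]
  refine integral_congr_ae (Filter.Eventually.of_forall fun u => ?_)
  have hw : Measurable fun z => ENNReal.ofReal (roundLik G z) :=
    (measurable_roundLik hG).ennreal_ofReal
  have : SigmaFinite (baseLaw.withDensity fun z => ENNReal.ofReal (roundLik G z)) := by
    change SigmaFinite (gapLaw G); infer_instance
  have hW : Measurable fun z : Fin T → I × (Bool → I) =>
      ∏ i, ENNReal.ofReal (roundLik G (z i)) :=
    Finset.measurable_prod _ fun i _ => hw.comp (measurable_pi_apply i)
  simp only [gapLaw]
  rw [pi_withDensity baseLaw hw, integral_withDensity_eq_integral_toReal_smul hW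
    (Filter.Eventually.of_forall fun z => ENNReal.prod_lt_top fun i _ => ENNReal.ofReal_lt_top)]
  refine integral_congr_ae (Filter.Eventually.of_forall fun z => ?_)
  simp only [ENNReal.toReal_prod, ENNReal.toReal_ofReal (roundLik_nonneg hG1 _), smul_eq_mul]
  exact mul_comm _ _

variable {ι : Type*} [Fintype ι] (Φ : BumpFamily ι)

/-- All contributions are nonnegative, so rounds, bumps and parts of the sample space may be
discarded. -/
theorem seedRegret_gap_ge (s : ι → Bool) (u : S) (K : Finset (Fin T)) (B : Finset ι)
    {E : Fin T → Set (Fin T → I × (Bool → I))} (hE : ∀ k, MeasurableSet (E k)) :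
    ∑ k ∈ K, ∑ b ∈ B, ∫ z, ((E k).indicator 1 z *
        (Φ.bump b (z k).1 * BumpFamily.wrongArm s b (π.action u z k)))
          * lik (Φ.gap s) Finset.univ z ∂baseRounds T
      ≤ π.seedRegret (Φ.gap s) u := by
  have h1E0 : ∀ k z, 0 ≤ (E k).indicator (1 : (Fin T → I × (Bool → I)) → ℝ) z := fun k z =>
    Set.indicator_nonneg (fun _ _ => zero_le_one) z
  have h1E1 : ∀ k z, (E k).indicator (1 : (Fin T → I × (Bool → I)) → ℝ) z ≤ 1 := fun k z =>
    Set.indicator_le_self' (fun _ _ => zero_le_one) z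
  have hpos : ∀ k b (z : Fin T → I × (Bool → I)),
      0 ≤ Φ.bump b (z k).1 * BumpFamily.wrongArm s b (π.action u z k) := fun k b z =>
    mul_nonneg (Φ.nonneg _ _) (BumpFamily.wrongArm_nonneg _ _ _)
  have hact : ∀ k, Measurable fun z => π.action u z k := fun k =>
    (π.measurable_action k).comp measurable_prodMk_left
  have hint : ∀ k b, Integrable (fun z => ((E k).indicator 1 z *
        (Φ.bump b (z k).1 * BumpFamily.wrongArm s b (π.action u z k)))
          * lik (Φ.gap s) Finset.univ z) (baseRounds T) := by
    intro k b
    refine integrable_mul_lik (Φ.measurable_gap s) (Φ.abs_gap_le_one s) _ (C := 1)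
      ((measurable_one.indicator (hE k)).mul
        (((Φ.measurable_bump b).comp (measurable_fst.comp (measurable_pi_apply k))).mul
          ((measurable_of_finite (BumpFamily.wrongArm s b)).comp (hact k)))) fun z => ?_
    rw [abs_of_nonneg (mul_nonneg (h1E0 k z) (hpos k b z))]
    exact mul_le_one₀ (h1E1 k z) (hpos k b z) (mul_le_one₀ (Φ.le_one _ _)
      (BumpFamily.wrongArm_nonneg _ _ _) (BumpFamily.wrongArm_le_one _ _ _))
  simp only [← integral_finsetSum B fun b _ => hint _ b]
  rw [← integral_finsetSum K fun k _ => integrable_finsetSum B fun b _ => hint k b]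
  refine integral_mono (integrable_finsetSum _ fun k _ => integrable_finsetSum _ fun b _ =>
    hint k b) ?_ fun z => ?_
  · exact integrable_mul_lik (Φ.measurable_gap s) (Φ.abs_gap_le_one s) _ (C := T)
      ((π.measurable_sum_roundLoss (Φ.measurable_gap s)).comp measurable_prodMk_left)
      fun z => π.abs_sum_roundLoss_le (Φ.abs_gap_le_one s) (u, z)
  · have hl := lik_nonneg (Φ.abs_gap_le_one s) Finset.univ z
    simp only [← Finset.sum_mul]
    refine mul_le_mul_of_nonneg_right ?_ hl
    calc ∑ k ∈ K, ∑ b ∈ B, (E k).indicator (1 : (Fin T → I × (Bool → I)) → ℝ) z *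
          (Φ.bump b (z k).1 * BumpFamily.wrongArm s b (π.action u z k))
        ≤ ∑ k ∈ K, ∑ b ∈ B, Φ.bump b (z k).1 * BumpFamily.wrongArm s b (π.action u z k) :=
          Finset.sum_le_sum fun k _ => Finset.sum_le_sum fun b _ =>
            mul_le_of_le_one_left (hpos k b z) (h1E1 k z)
      _ ≤ ∑ k, ∑ b, Φ.bump b (z k).1 * BumpFamily.wrongArm s b (π.action u z k) :=
          (Finset.sum_le_sum fun k _ => Finset.sum_le_sum_of_subset_of_nonneg
            (Finset.subset_univ B) fun b _ _ => hpos k b z).trans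
          (Finset.sum_le_sum_of_subset_of_nonneg (Finset.subset_univ K) fun k _ _ =>
            Finset.sum_nonneg fun b _ => hpos k b z)
      _ = _ := by simp only [Φ.roundLoss_gap]

variable [DecidableEq ι]

/-- The worst sign vector is at least as bad as the average over the `2 ^ card` vertices. The vertex
is chosen after averaging over the seed, so it does not depend on `u`. -/
theorem exists_regret_ge_of_sum (ν : Measure S) [IsProbabilityMeasure ν] {q : S → ℝ}
    (hq : Integrable q ν) (h : ∀ u, q u ≤ ∑ s, π.seedRegret (Φ.gap s) u) :
    ∃ s, (∫ u, q u ∂ν) / 2 ^ Fintype.card ι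
      ≤ π.regret ν (gapInstance (Φ.gap s) (Φ.measurable_gap s) (Φ.abs_gap_le_one s)) := by
  have hi := fun s => π.integrable_seedRegret ν (Φ.measurable_gap s) (Φ.abs_gap_le_one s)
  have h1 : ∫ u, q u ∂ν ≤ ∑ s, ∫ u, π.seedRegret (Φ.gap s) u ∂ν := by
    rw [← integral_finsetSum _ fun s _ => hi s]
    exact integral_mono hq (integrable_finsetSum _ fun s _ => hi s) h
  simp only [regret_gapInstance]
  by_contra hcon
  push Not at hcon
  have h2 := Finset.sum_lt_sum_of_nonempty (s := (Finset.univ : Finset (ι → Bool)))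
    Finset.univ_nonempty fun s _ => hcon s
  rw [Finset.sum_const, Finset.card_univ, Fintype.card_fun, Fintype.card_bool, nsmul_eq_mul] at h2
  push_cast at h2
  rw [mul_div_cancel₀ _ (by positivity)] at h2
  linarith

/-- The probability of a long batch, summed over the hypercube. -/
noncomputable def longBatchMass (i n N : ℕ) (u : S) : ℝ :=
  ∑ s, ∫ z, (π.longBatch u i n N).indicator 1 z * lik (Φ.gap s) Finset.univ z ∂baseRounds T

theorem integrable_longBatchMass (ν : Measure S) [IsProbabilityMeasure ν] {i : ℕ} (hi : i < M)
    (n N : ℕ) : Integrable (π.longBatchMass Φ i n N) ν := by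
  refine integrable_finsetSum _ fun s _ => ?_
  exact integrable_mul_lik_prod ν (Φ.measurable_gap s) (Φ.abs_gap_le_one s) (C := 1)
    (F := {p : S × (Fin T → I × (Bool → I)) | p.2 ∈ π.longBatch p.1 i n N}.indicator 1)
    (measurable_one.indicator (π.measurableSet_longBatch_prod hi n N)) fun p => by
      by_cases hp : p ∈ {p : S × (Fin T → I × (Bool → I)) | p.2 ∈ π.longBatch p.1 i n N}
      · rw [Set.indicator_of_mem hp]; simp
      · rw [Set.indicator_of_notMem hp]; simp

/-- If batch `i + 1` is likely to contain all rounds between `n` and `N`, then a hypercube whose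
bumps cannot be detected in `n` rounds forces a large regret. -/
theorem exists_regret_ge_of_longBatch (ν : Measure S) [IsProbabilityMeasure ν] {i n N : ℕ}
    (hi : i < M) (hN : N ≤ T) (B : Finset ι)
    (hB : ∀ b ∈ B, 6 * (n * ∫ x, Φ.bump b x ^ 2) ≤ (1 / (M : ℝ)) ^ 2)
    (hmass : 2 ^ Fintype.card ι / (M : ℝ) ≤ ∫ u, π.longBatchMass Φ i n N u ∂ν) :
    ∃ s, ((N : ℝ) - n) * (∑ b ∈ B, ∫ x, Φ.bump b x) / (4 * M)
      ≤ π.regret ν (gapInstance (Φ.gap s) (Φ.measurable_gap s) (Φ.abs_gap_le_one s)) := by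
  have hM : 0 < (M : ℝ) := by exact_mod_cast (Nat.zero_le i).trans_lt hi
  have hM1 : 1 / (M : ℝ) ≤ 1 := by
    rw [div_le_one hM]; exact_mod_cast (Nat.succ_le_of_lt ((Nat.zero_le i).trans_lt hi))
  have hm0 : 0 ≤ ∑ b ∈ B, ∫ x, Φ.bump b x :=
    Finset.sum_nonneg fun b _ => integral_nonneg fun x => Φ.nonneg b x
  set K : Finset (Fin T) := Finset.univ.filter fun k => n ≤ (k : ℕ) ∧ (k : ℕ) < N with hK
  have hKcard : (N : ℝ) - n ≤ K.card := by
    have : (Finset.Ico n N).card ≤ K.card := by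
      refine Finset.card_le_card_of_surjOn (fun k : Fin T => (k : ℕ)) fun m hm => ?_
      have hm' := Finset.mem_Ico.1 (Finset.mem_coe.1 hm)
      exact ⟨⟨m, by omega⟩, by simp [hK, hm'.1, hm'.2], rfl⟩
    rw [Nat.card_Ico] at this
    have h2 : N ≤ K.card + n := by omega
    have h3 : (N : ℝ) ≤ K.card + n := by exact_mod_cast h2
    linarith
  have hpt : ∀ u, (K.card : ℝ) * ((∑ b ∈ B, ∫ x, Φ.bump b x) / 2 *
      (π.longBatchMass Φ i n N u - 2 ^ Fintype.card ι * (1 / M / 2)))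
      ≤ ∑ s, π.seedRegret (Φ.gap s) u := by
    intro u
    refine le_trans ?_ (Finset.sum_le_sum fun s _ => π.seedRegret_gap_ge Φ s u K B
      (E := fun _ => π.longBatch u i n N) fun _ => π.measurableSet_longBatch u hi n N)
    rw [Finset.sum_comm, ← nsmul_eq_mul, ← Finset.sum_const]
    refine Finset.sum_le_sum fun k hk => ?_
    rw [Finset.sum_comm, Finset.sum_div, Finset.sum_mul]
    refine Finset.sum_le_sum fun b hb => ?_
    have hk' := (Finset.mem_filter.1 hk).2
    exact Φ.sum_integral_wrongArm_ge b hk'.1 (π.measurableSet_longBatch u hi n N)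
      (fun z z' h hz => π.longBatch_congr u hi h hz)
      ((π.measurable_action k).comp measurable_prodMk_left)
      (fun z z' hz hx h => π.action_congr_longBatch u hi hz hk'.1 hk'.2 hx h)
      (by positivity) hM1 (hB b hb)
  have hqi : Integrable (fun u => (K.card : ℝ) * ((∑ b ∈ B, ∫ x, Φ.bump b x) / 2 *
      (π.longBatchMass Φ i n N u - 2 ^ Fintype.card ι * (1 / M / 2)))) ν :=
    (((π.integrable_longBatchMass Φ ν hi n N).sub (integrable_const _)).const_mul _).const_mul _
  obtain ⟨s, hs⟩ := π.exists_regret_ge_of_sum Φ ν hqi hpt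
  refine ⟨s, le_trans ?_ hs⟩
  rw [integral_const_mul, integral_const_mul,
    integral_sub (π.integrable_longBatchMass Φ ν hi n N) (integrable_const _), integral_const,
    probReal_univ, one_smul, le_div_iff₀ (by positivity)]
  set m := ∑ b ∈ B, ∫ x, Φ.bump b x
  set Q := ∫ u, π.longBatchMass Φ i n N u ∂ν
  -- The testing error `η = 1 / M` eats up at most half of the mass `1 / M` of the event.
  have h1 : (2 : ℝ) ^ Fintype.card ι / (2 * M) ≤ Q - 2 ^ Fintype.card ι * (1 / M / 2) := by
    have : (2 : ℝ) ^ Fintype.card ι / M = 2 ^ Fintype.card ι / (2 * M)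
        + 2 ^ Fintype.card ι * (1 / M / 2) := by field_simp; norm_num
    linarith
  calc ((N : ℝ) - n) * m / (4 * M) * 2 ^ Fintype.card ι
      = ((N : ℝ) - n) * (m / 2 * (2 ^ Fintype.card ι / (2 * M))) := by field_simp; norm_num
    _ ≤ K.card * (m / 2 * (2 ^ Fintype.card ι / (2 * M))) := by gcongr
    _ ≤ K.card * (m / 2 * (Q - 2 ^ Fintype.card ι * (1 / M / 2))) := by gcongr

/-- A hypercube whose bumps cannot be detected in `T` rounds forces a large regret, whatever the
batches are. -/
theorem exists_regret_ge (ν : Measure S) [IsProbabilityMeasure ν]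
    (hB : ∀ b, 6 * (T * ∫ x, Φ.bump b x ^ 2) ≤ 1) :
    ∃ s, (T : ℝ) * (∑ b, ∫ x, Φ.bump b x) / 4
      ≤ π.regret ν (gapInstance (Φ.gap s) (Φ.measurable_gap s) (Φ.abs_gap_le_one s)) := by
  have hpt : ∀ u, (T : ℝ) * ((∑ b, ∫ x, Φ.bump b x) / 2 *
      (2 ^ Fintype.card ι - 2 ^ Fintype.card ι * (1 / 2)))
      ≤ ∑ s, π.seedRegret (Φ.gap s) u := by
    intro u
    refine le_trans ?_ (Finset.sum_le_sum fun s _ => π.seedRegret_gap_ge Φ s u Finset.univ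
      Finset.univ (E := fun _ => Set.univ) fun _ => MeasurableSet.univ)
    rw [Finset.sum_comm]
    have hT : (T : ℝ) = (Finset.univ : Finset (Fin T)).card := by simp
    nth_rewrite 1 [hT]
    rw [← nsmul_eq_mul, ← Finset.sum_const]
    refine Finset.sum_le_sum fun k _ => ?_
    rw [Finset.sum_comm, Finset.sum_div, Finset.sum_mul]
    refine Finset.sum_le_sum fun b _ => ?_
    have hv : 6 * ((k : ℕ) * ∫ x, Φ.bump b x ^ 2) ≤ (1 : ℝ) ^ 2 := by
      rw [one_pow]
      refine le_trans ?_ (hB b)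
      have : ((k : ℕ) : ℝ) ≤ T := by exact_mod_cast k.2.le
      have h0 : 0 ≤ ∫ x, Φ.bump b x ^ 2 := integral_nonneg fun x => sq_nonneg _
      gcongr
    -- Here `n = k` and the event is everything: even a policy that sees all earlier rounds errs
    -- with constant probability.
    have h := Φ.sum_integral_wrongArm_ge b (le_refl (k : ℕ)) MeasurableSet.univ
      (fun _ _ _ _ => Set.mem_univ _)
      ((π.measurable_action k).comp (measurable_prodMk_left (x := u)))
      (fun z z' _ hx h => π.action_congr u hx fun l hl => h l hl) zero_lt_one le_rfl hv
    have hone : ∑ s, ∫ z, (Set.univ : Set (Fin T → I × (Bool → I))).indicator 1 z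
        * lik (Φ.gap s) Finset.univ z ∂baseRounds T = 2 ^ Fintype.card ι := by
      simp only [Set.indicator_univ, Pi.one_apply, one_mul,
        integral_lik (Φ.measurable_gap _) (Φ.abs_gap_le_one _)]
      simp
    rw [hone] at h
    exact h
  obtain ⟨s, hs⟩ := π.exists_regret_ge_of_sum Φ ν (integrable_const _) hpt
  refine ⟨s, le_trans (le_of_eq ?_) hs⟩
  rw [integral_const, probReal_univ, one_smul]
  field_simp
  norm_num

/-- One of the batches is long with probability at least `1 / M` on average. -/
theorem exists_longBatchMass_ge (ν : Measure S) [IsProbabilityMeasure ν] (hM : 0 < M) {τ : ℕ → ℕ}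
    (hτ : τ M < T) :
    ∃ i < M, 2 ^ Fintype.card ι / (M : ℝ)
      ≤ ∫ u, π.longBatchMass Φ i (τ i) (τ (i + 1)) u ∂ν := by
  by_contra hcon
  push Not at hcon
  have h1 : ∑ i ∈ Finset.range M, ∫ u, π.longBatchMass Φ i (τ i) (τ (i + 1)) u ∂ν
      < ∑ i ∈ Finset.range M, 2 ^ Fintype.card ι / (M : ℝ) :=
    Finset.sum_lt_sum_of_nonempty ⟨0, Finset.mem_range.2 hM⟩
      fun i hi => hcon i (Finset.mem_range.1 hi)
  have hM' : (M : ℝ) ≠ 0 := by exact_mod_cast hM.ne'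
  rw [Finset.sum_const, Finset.card_range, nsmul_eq_mul, mul_div_cancel₀ _ hM',
    ← integral_finsetSum _ fun i hi =>
      π.integrable_longBatchMass Φ ν (Finset.mem_range.1 hi) _ _] at h1
  have h2 : ∀ u, (2 : ℝ) ^ Fintype.card ι
      ≤ ∑ i ∈ Finset.range M, π.longBatchMass Φ i (τ i) (τ (i + 1)) u := by
    intro u
    simp only [longBatchMass]
    rw [Finset.sum_comm]
    -- For each sign vector the long-batch events cover the sample space, so their probabilities add
    -- up to at least `1`.
    have hs : ∀ s : ι → Bool, (1 : ℝ) ≤ ∑ i ∈ Finset.range M,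
        ∫ z, (π.longBatch u i (τ i) (τ (i + 1))).indicator 1 z * lik (Φ.gap s) Finset.univ z
          ∂baseRounds T := by
      intro s
      have hint : ∀ i ∈ Finset.range M, Integrable (fun z =>
          (π.longBatch u i (τ i) (τ (i + 1))).indicator 1 z * lik (Φ.gap s) Finset.univ z)
          (baseRounds T) := fun i hi =>
        integrable_mul_lik (Φ.measurable_gap s) (Φ.abs_gap_le_one s) _ (C := 1)
          (measurable_one.indicator (π.measurableSet_longBatch u (Finset.mem_range.1 hi) _ _))
          fun z => by
            by_cases hz : z ∈ π.longBatch u i (τ i) (τ (i + 1))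
            · rw [Set.indicator_of_mem hz]; simp
            · rw [Set.indicator_of_notMem hz]; simp
      rw [← integral_finsetSum _ hint,
        ← integral_lik (T := T) (Φ.measurable_gap s) (Φ.abs_gap_le_one s) Finset.univ]
      refine integral_mono (integrable_of_forall_abs_le (measurable_lik (Φ.measurable_gap s) _)
        (abs_lik_le (Φ.abs_gap_le_one s) _)) (integrable_finsetSum _ hint) fun z => ?_
      have hl := lik_nonneg (Φ.abs_gap_le_one s) Finset.univ z
      obtain ⟨i, hi, hz⟩ := π.exists_mem_longBatch u z hτ
      refine le_trans (le_of_eq ?_) (Finset.single_le_sum (f := fun i =>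
        (π.longBatch u i (τ i) (τ (i + 1))).indicator 1 z * lik (Φ.gap s) Finset.univ z)
        (fun j _ => mul_nonneg (Set.indicator_nonneg (fun _ _ => zero_le_one) z) hl) hi)
      simp only [Set.indicator_of_mem hz, Pi.one_apply, one_mul]
    have := Finset.sum_le_sum fun s (_ : s ∈ (Finset.univ : Finset (ι → Bool))) => hs s
    simpa using this
  have h3 := integral_mono (μ := ν) (integrable_const _) (integrable_finsetSum _ fun i hi =>
    π.integrable_longBatchMass Φ ν (Finset.mem_range.1 hi) (τ i) (τ (i + 1))) h2
  rw [integral_const, probReal_univ, one_smul] at h3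
  linarith

/-- The length of the first batch depends on the seed only. -/
theorem longBatchMass_zero (hM : 0 < M) (n N : ℕ) (u : S) (z₀ : Fin T → I × (Bool → I)) :
    π.longBatchMass Φ 0 n N u
      = 2 ^ Fintype.card ι * (π.longBatch u 0 n N).indicator 1 z₀ := by
  have h0 : ∀ z, (π.longBatch u 0 n N).indicator (1 : (Fin T → I × (Bool → I)) → ℝ) z
      = (π.longBatch u 0 n N).indicator 1 z₀ := by
    intro z
    have hg : ∀ z', π.gridAt u z' 0 = 0 := fun z' => π.grid_zero u _ _
    have h1 : π.gridAt u z (0 + 1) = π.gridAt u z₀ (0 + 1) :=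
      π.gridAt_succ_congr u hM (n := 0) (hg z).le fun l hl => absurd hl (Nat.not_lt_zero _)
    have : z ∈ π.longBatch u 0 n N ↔ z₀ ∈ π.longBatch u 0 n N := by
      simp only [longBatch, Set.mem_ofPred_eq, hg, h1]
    by_cases hz : z ∈ π.longBatch u 0 n N
    · rw [Set.indicator_of_mem hz, Set.indicator_of_mem (this.1 hz)]; rfl
    · rw [Set.indicator_of_notMem hz, Set.indicator_of_notMem (fun h => hz (this.2 h))]
  simp only [longBatchMass, h0, integral_const_mul,
    integral_lik (Φ.measurable_gap _) (Φ.abs_gap_le_one _)]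
  simp

end BatchedPolicy

/-! ### Tents -/

/-- The tent of slope `a` over the interval of radius `r` around `p`. -/
noncomputable def tent (a p r : ℝ) (x : I) : ℝ := max 0 (a * (r - |(x : ℝ) - p|))

theorem measurable_tent (a p r : ℝ) : Measurable (tent a p r) := by
  unfold tent; fun_prop

theorem tent_nonneg (a p r : ℝ) (x : I) : 0 ≤ tent a p r x := le_max_left _ _

theorem tent_le {a r : ℝ} (ha : 0 ≤ a) (hr : 0 ≤ r) (p : ℝ) (x : I) : tent a p r x ≤ a * r :=
  max_le (mul_nonneg ha hr) (mul_le_mul_of_nonneg_left (by linarith [abs_nonneg ((x : ℝ) - p)]) ha)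

theorem tent_pos_iff {a : ℝ} (ha : 0 < a) (p r : ℝ) (x : I) :
    0 < tent a p r x ↔ |(x : ℝ) - p| < r := by
  rw [tent, lt_max_iff]
  simp only [lt_self_iff_false, false_or, mul_pos_iff_of_pos_left ha, sub_pos]

theorem tent_eq_of_pos {a p r : ℝ} {x : I} (h : 0 < tent a p r x) :
    tent a p r x = a * (r - |(x : ℝ) - p|) := by
  rw [tent] at h ⊢
  rcases lt_max_iff.1 h with h | h
  · exact absurd h (lt_irrefl _)
  · exact max_eq_right h.le

theorem abs_tent_sub_tent_le {a : ℝ} (ha : 0 ≤ a) (p r : ℝ) (x x' : I) :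
    |tent a p r x - tent a p r x'| ≤ a * |(x : ℝ) - x'| := by
  unfold tent
  refine (abs_max_sub_max_le_max _ _ _ _).trans ?_
  rw [sub_self, abs_zero, ← mul_sub, abs_mul, abs_of_nonneg ha, max_eq_right (by positivity)]
  refine mul_le_mul_of_nonneg_left ?_ ha
  rw [show r - |(x : ℝ) - p| - (r - |(x' : ℝ) - p|) = |(x' : ℝ) - p| - |(x : ℝ) - p| by ring]
  refine (abs_abs_sub_abs_le_abs_sub _ _).trans (le_of_eq ?_)
  rw [abs_sub_comm]; congr 1; ring

theorem volume_real_Icc_le (l u : ℝ) (hlu : l ≤ u) :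
    (volume : Measure I).real {x | l ≤ (x : ℝ) ∧ (x : ℝ) ≤ u} ≤ u - l := by
  rw [Measure.real, unitInterval.volume_apply]
  refine ENNReal.toReal_le_of_le_ofReal (by linarith) ?_
  rw [← Real.volume_Icc]
  refine measure_mono ?_
  rintro _ ⟨x, hx, rfl⟩
  exact hx

theorem volume_real_Icc_eq {l u : ℝ} (hl : 0 ≤ l) (hlu : l ≤ u) (hu : u ≤ 1) :
    (volume : Measure I).real {x | l ≤ (x : ℝ) ∧ (x : ℝ) ≤ u} = u - l := by
  have : {x : I | l ≤ (x : ℝ) ∧ (x : ℝ) ≤ u}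
      = Set.Icc (⟨l, hl, hlu.trans hu⟩ : I) ⟨u, hl.trans hlu, hu⟩ := by
    ext x; simp [← Subtype.coe_le_coe]
  rw [this, Measure.real, unitInterval.volume_Icc, ENNReal.toReal_ofReal (by simpa using hlu)]

theorem measurableSet_coe_Icc (l u : ℝ) : MeasurableSet {x : I | l ≤ (x : ℝ) ∧ (x : ℝ) ≤ u} :=
  (measurableSet_le measurable_const measurable_subtype_coe).inter
    (measurableSet_le measurable_subtype_coe measurable_const)

theorem integral_tent_sq_le {a r : ℝ} (ha : 0 < a) (ha1 : a ≤ 1) (hr : 0 ≤ r) (p : ℝ) :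
    ∫ x, tent a p r x ^ 2 ≤ 2 * r ^ 3 := by
  set A : Set I := {x | p - r ≤ (x : ℝ) ∧ (x : ℝ) ≤ p + r} with hA
  have hAm : MeasurableSet A := measurableSet_coe_Icc _ _
  have hle : ∀ x, tent a p r x ^ 2 ≤ A.indicator (fun _ => r ^ 2) x := by
    intro x
    have har : a * r ≤ r := mul_le_of_le_one_left hr ha1
    by_cases hx : x ∈ A
    · rw [Set.indicator_of_mem hx]
      exact pow_le_pow_left₀ (tent_nonneg _ _ _ _) ((tent_le ha.le hr p x).trans har) 2
    · rw [Set.indicator_of_notMem hx]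
      have h0 : tent a p r x = 0 := by
        by_contra hne
        have := (tent_pos_iff ha p r x).1 (lt_of_le_of_ne (tent_nonneg _ _ _ _) (Ne.symm hne))
        rw [abs_lt] at this
        exact hx ⟨by linarith, by linarith⟩
      rw [h0]; norm_num
  have hint : Integrable (A.indicator fun _ : I => r ^ 2) (volume : Measure I) :=
    (integrable_const _).indicator hAm
  have h := integral_mono_of_nonneg (Filter.Eventually.of_forall fun x => sq_nonneg (tent a p r x))
    hint (Filter.Eventually.of_forall hle)
  rw [integral_indicator_const _ hAm, smul_eq_mul] at h
  have hv := volume_real_Icc_le (p - r) (p + r) (by linarith)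
  calc _ ≤ _ := h
    _ ≤ (p + r - (p - r)) * r ^ 2 := mul_le_mul_of_nonneg_right hv (sq_nonneg r)
    _ = _ := by ring

/-- On the middle half of its base the tent has at least half its height. -/
theorem le_integral_tent {a p r : ℝ} (ha : 0 < a) (hr : 0 ≤ r) (hp0 : r ≤ p) (hp1 : p + r ≤ 1) :
    a * r ^ 2 / 2 ≤ ∫ x, tent a p r x := by
  set A : Set I := {x | p - r / 2 ≤ (x : ℝ) ∧ (x : ℝ) ≤ p + r / 2} with hA
  have hAm : MeasurableSet A := measurableSet_coe_Icc _ _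
  have hle : ∀ x, A.indicator (fun _ => a * (r / 2)) x ≤ tent a p r x := by
    intro x
    by_cases hx : x ∈ A
    · rw [Set.indicator_of_mem hx]
      refine le_max_of_le_right (mul_le_mul_of_nonneg_left ?_ ha.le)
      have : |(x : ℝ) - p| ≤ r / 2 := abs_le.2 ⟨by linarith [hx.1], by linarith [hx.2]⟩
      linarith
    · rw [Set.indicator_of_notMem hx]
      exact tent_nonneg _ _ _ _
  have hint : Integrable (tent a p r) (volume : Measure I) :=
    integrable_of_forall_abs_le (C := a * r) (measurable_tent a p r) fun x => by
      rw [abs_of_nonneg (tent_nonneg _ _ _ _)]; exact tent_le ha.le hr p x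
  have h := integral_mono ((integrable_const _).indicator hAm) hint hle
  rw [integral_indicator_const _ hAm, smul_eq_mul,
    volume_real_Icc_eq (by linarith) (by linarith) (by linarith)] at h
  linarith

/-- The set has length at most `2 * r` and at most `2 * (δ / a)`, from two end strips. The geometric
mean of the two bounds has the power `δ ^ (1 / 2)` of the margin `α = 1/2`, for every radius at
once. -/
theorem volume_tent_le {a r δ : ℝ} (ha : 0 < a) (hr : 0 ≤ r) (hδ : 0 ≤ δ) (p : ℝ) :
    (volume : Measure I).real {x | 0 < tent a p r x ∧ tent a p r x ≤ δ}
      ≤ 2 * √(r * (δ / a)) := by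
  have hδa : 0 ≤ δ / a := by positivity
  rcases le_total r (δ / a) with h | h
  · have h1 : r ≤ √(r * (δ / a)) := Real.le_sqrt_of_sq_le (by nlinarith)
    have h2 : (volume : Measure I).real {x | 0 < tent a p r x ∧ tent a p r x ≤ δ}
        ≤ (volume : Measure I).real {x | p - r ≤ (x : ℝ) ∧ (x : ℝ) ≤ p + r} := by
      refine measureReal_mono fun x hx => ?_
      have := abs_lt.1 ((tent_pos_iff ha p r x).1 hx.1)
      exact ⟨by linarith, by linarith⟩
    have h3 := volume_real_Icc_le (p - r) (p + r) (by linarith)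
    linarith
  · have h1 : δ / a ≤ √(r * (δ / a)) := Real.le_sqrt_of_sq_le (by nlinarith)
    have h2 : (volume : Measure I).real {x | 0 < tent a p r x ∧ tent a p r x ≤ δ}
        ≤ (volume : Measure I).real ({x | p - r ≤ (x : ℝ) ∧ (x : ℝ) ≤ p - r + δ / a}
          ∪ {x | p + r - δ / a ≤ (x : ℝ) ∧ (x : ℝ) ≤ p + r}) := by
      refine measureReal_mono fun x hx => ?_
      have h4 := (tent_pos_iff ha p r x).1 hx.1
      have h5 := hx.2
      rw [tent_eq_of_pos hx.1, ← le_div_iff₀' ha] at h5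
      rcases le_total 0 ((x : ℝ) - p) with h6 | h6
      · rw [abs_of_nonneg h6] at h4 h5
        exact Or.inr ⟨by linarith, by linarith⟩
      · rw [abs_of_nonpos h6] at h4 h5
        exact Or.inl ⟨by linarith, by linarith⟩
    have h3 := measureReal_union_le (μ := (volume : Measure I))
      {x : I | p - r ≤ (x : ℝ) ∧ (x : ℝ) ≤ p - r + δ / a}
      {x : I | p + r - δ / a ≤ (x : ℝ) ∧ (x : ℝ) ≤ p + r}
    have h4 := volume_real_Icc_le (p - r) (p - r + δ / a) (by linarith)
    have h5 := volume_real_Icc_le (p + r - δ / a) (p + r) (by linarith)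
    linarith

/-- Tents over pairwise disjoint intervals. -/
noncomputable def tentFamily {ι : Type*} (a : ℝ) (p r : ι → ℝ) (ha : 0 < a) (ha1 : a ≤ 1)
    (hr : ∀ b, 0 ≤ r b) (hr1 : ∀ b, r b ≤ 1)
    (hsep : ∀ b b', b ≠ b' → r b + r b' ≤ |p b - p b'|) : BumpFamily ι where
  bump b := tent a (p b) (r b)
  measurable_bump b := measurable_tent _ _ _
  nonneg b := tent_nonneg _ _ _
  le_one b x := (tent_le ha.le (hr b) _ x).trans (mul_le_one₀ ha1 (hr b) (hr1 b))
  mul_eq_zero b b' hne x := by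
    by_contra h
    have h1 : 0 < tent a (p b) (r b) x :=
      lt_of_le_of_ne (tent_nonneg _ _ _ _) (Ne.symm (left_ne_zero_of_mul h))
    have h2 : 0 < tent a (p b') (r b') x :=
      lt_of_le_of_ne (tent_nonneg _ _ _ _) (Ne.symm (right_ne_zero_of_mul h))
    rw [tent_pos_iff ha] at h1 h2
    have h3 := abs_sub_le (p b) (x : ℝ) (p b')
    rw [abs_sub_comm (p b) (x : ℝ)] at h3
    linarith [hsep b b' hne]

section TentFamily

variable {ι : Type*} [Fintype ι] {a : ℝ} {p r : ι → ℝ} (ha : 0 < a) (ha1 : a ≤ 1)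
  (hr : ∀ b, 0 ≤ r b) (hr1 : ∀ b, r b ≤ 1)
  (hsep : ∀ b b', b ≠ b' → r b + r b' ≤ |p b - p b'|)

theorem abs_tentFamily_gap_sub_le (s : ι → Bool) (x x' : I) :
    |(tentFamily a p r ha ha1 hr hr1 hsep).gap s x
      - (tentFamily a p r ha ha1 hr hr1 hsep).gap s x'| ≤ a * |(x : ℝ) - x'| := by
  classical
  set Φ := tentFamily a p r ha ha1 hr hr1 hsep with hΦ
  have hlip : ∀ b, |Φ.bump b x - Φ.bump b x'| ≤ a * |(x : ℝ) - x'| := fun b =>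
    abs_tent_sub_tent_le ha.le (p b) (r b) x x'
  have hsingle : ∀ b, |(if s b then Φ.bump b x else -Φ.bump b x)
      - (if s b then Φ.bump b x' else -Φ.bump b x')| ≤ a * |(x : ℝ) - x'| := by
    intro b
    split_ifs
    · exact hlip b
    · rw [neg_sub_neg, abs_sub_comm]; exact hlip b
  rcases Φ.exists_active x with h | ⟨b, hb, h⟩ <;> rcases Φ.exists_active x' with h' | ⟨b', hb', h'⟩
  · rw [Φ.gap_eq_zero s h, Φ.gap_eq_zero s h', sub_self, abs_zero]; positivity
  · have := hsingle b'
    rwa [Φ.gap_eq_active s h', Φ.gap_eq_active s (b := b') fun b _ => h b]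
  · have := hsingle b
    rwa [Φ.gap_eq_active s h, Φ.gap_eq_active s (b := b) fun b _ => h' b]
  · by_cases hbb : b = b'
    · subst hbb
      rw [Φ.gap_eq_active s h, Φ.gap_eq_active s h']; exact hsingle b
    -- On different tents the signs may be opposite, so the two heights are added. They are
    -- controlled by the distances to the edges of the tents, which `hsep` places between `x` and
    -- `x'`.
    · refine (abs_sub _ _).trans ?_
      rw [Φ.abs_gap_eq_sum, Φ.abs_gap_eq_sum,
        Finset.sum_eq_single b (fun c _ hc => h c hc) (by simp),
        Finset.sum_eq_single b' (fun c _ hc => h' c hc) (by simp)]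
      have e1 : Φ.bump b x = a * (r b - |(x : ℝ) - p b|) :=
        tent_eq_of_pos (lt_of_le_of_ne (tent_nonneg _ _ _ _) (Ne.symm hb))
      have e2 : Φ.bump b' x' = a * (r b' - |(x' : ℝ) - p b'|) :=
        tent_eq_of_pos (lt_of_le_of_ne (tent_nonneg _ _ _ _) (Ne.symm hb'))
      rw [e1, e2, ← mul_add]
      refine mul_le_mul_of_nonneg_left ?_ ha.le
      have h1 := abs_sub_le (p b) (x : ℝ) (p b')
      have h2 := abs_sub_le (x : ℝ) (x' : ℝ) (p b')
      rw [abs_sub_comm (p b) (x : ℝ)] at h1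
      linarith [hsep b b' hbb]

theorem volume_tentFamily_gap_le (s : ι → Bool) {δ : ℝ} (hδ : 0 ≤ δ) :
    (volume : Measure I).real {x | 0 < |(tentFamily a p r ha ha1 hr hr1 hsep).gap s x|
        ∧ |(tentFamily a p r ha ha1 hr hr1 hsep).gap s x| ≤ δ}
      ≤ 2 * (√(δ / a) * ∑ b, √(r b)) := by
  classical
  set Φ := tentFamily a p r ha ha1 hr hr1 hsep with hΦ
  have hsub : {x | 0 < |Φ.gap s x| ∧ |Φ.gap s x| ≤ δ}
      ⊆ ⋃ b ∈ (Finset.univ : Finset ι),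
        {x | 0 < tent a (p b) (r b) x ∧ tent a (p b) (r b) x ≤ δ} := by
    intro x hx
    rcases Φ.exists_active x with h | ⟨b, -, h⟩
    · have := hx.1
      rw [Φ.gap_eq_zero s h] at this
      simp at this
    · have e : |Φ.gap s x| = tent a (p b) (r b) x := by
        rw [Φ.abs_gap_eq_sum, Finset.sum_eq_single b (fun c _ hc => h c hc) (by simp)]
        rfl
      have hx' : 0 < |Φ.gap s x| ∧ |Φ.gap s x| ≤ δ := hx
      rw [e] at hx'
      exact Set.mem_biUnion (Finset.mem_coe.2 (Finset.mem_univ b)) hx'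
  refine (measureReal_mono hsub (measure_ne_top _ _)).trans
    ((measureReal_biUnion_finset_le _ _).trans ?_)
  rw [Finset.mul_sum, Finset.mul_sum]
  refine Finset.sum_le_sum fun b _ => (volume_tent_le ha (hr b) hδ (p b)).trans (le_of_eq ?_)
  rw [Real.sqrt_mul (hr b), mul_comm (√(r b))]

end TentFamily

/-! ### Hypercubes with bumps of several sizes -/

section Levels

variable {K : ℕ} (B : ℝ) (m : Fin K → ℕ)

/-- The radius of the tents of level `i`. -/
noncomputable def levelRadius (i : Fin K) : ℝ := (B / (K * m i)) ^ 2

/-- The centers of the tents: those of level `i` fill an initial part of `[i / K, (i + 1) / K]`. -/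
noncomputable def levelCenter (b : (i : Fin K) × Fin (m i)) : ℝ :=
  (b.1 : ℕ) / K + (2 * (b.2 : ℕ) + 1) * levelRadius B m b.1

theorem levelRadius_nonneg (i : Fin K) : 0 ≤ levelRadius B m i := sq_nonneg _

variable {B m}

/-- The tents of a level, laid side by side, fit into an interval of length `1 / K`. -/
theorem card_mul_levelRadius_le (hB0 : 0 ≤ B) (hB : B ≤ 1 / 2) {i : Fin K} (hm : 1 ≤ m i) :
    2 * (m i * levelRadius B m i) ≤ 1 / K := by
  have hK : (1 : ℝ) ≤ K := by exact_mod_cast (Nat.zero_le _).trans_lt i.2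
  have hm' : (1 : ℝ) ≤ m i := by exact_mod_cast hm
  have h1 : 2 * (m i * levelRadius B m i) = (2 * B ^ 2) / (K * m i) * (1 / K) := by
    unfold levelRadius; field_simp
  rw [h1]
  refine mul_le_of_le_one_left (by positivity) ?_
  rw [div_le_one (by positivity)]
  nlinarith

theorem levelCenter_add_le (hB0 : 0 ≤ B) (hB : B ≤ 1 / 2) (b : (i : Fin K) × Fin (m i)) :
    levelCenter B m b + levelRadius B m b.1 ≤ ((b.1 : ℕ) + 1) / K := by
  have h := card_mul_levelRadius_le hB0 hB (i := b.1) ((Nat.zero_le _).trans_lt b.2.2)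
  have h0 := levelRadius_nonneg B m b.1
  have hj : ((b.2 : ℕ) : ℝ) + 1 ≤ m b.1 := by exact_mod_cast b.2.2
  unfold levelCenter
  rw [add_div]
  nlinarith

theorem le_levelCenter_sub (b : (i : Fin K) × Fin (m i)) :
    ((b.1 : ℕ) : ℝ) / K ≤ levelCenter B m b - levelRadius B m b.1 := by
  have h0 := levelRadius_nonneg B m b.1
  have hj : (0 : ℝ) ≤ (b.2 : ℕ) := Nat.cast_nonneg _
  unfold levelCenter
  nlinarith

theorem levelRadius_add_le (hB0 : 0 ≤ B) (hB : B ≤ 1 / 2) (b b' : (i : Fin K) × Fin (m i))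
    (hne : b ≠ b') :
    levelRadius B m b.1 + levelRadius B m b'.1 ≤ |levelCenter B m b - levelCenter B m b'| := by
  have aux : ∀ c c' : (i : Fin K) × Fin (m i), c.1 < c'.1 →
      levelRadius B m c.1 + levelRadius B m c'.1 ≤ levelCenter B m c' - levelCenter B m c := by
    intro c c' hlt
    have hK : (0 : ℝ) < K := by exact_mod_cast (Nat.zero_le _).trans_lt c.1.2
    have h1 := levelCenter_add_le hB0 hB c
    have h2 := le_levelCenter_sub (B := B) c'
    have h3 : (((c.1 : ℕ) : ℝ) + 1) / K ≤ ((c'.1 : ℕ) : ℝ) / K := by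
      gcongr; exact_mod_cast Fin.lt_def.1 hlt
    linarith
  rcases lt_trichotomy b.1 b'.1 with h | h | h
  · exact (aux b b' h).trans (by rw [abs_sub_comm]; exact le_abs_self _)
  · obtain ⟨i, j⟩ := b
    obtain ⟨i', j'⟩ := b'
    simp only at h
    subst h
    have h0 := levelRadius_nonneg B m i
    have hjj : j ≠ j' := fun h => hne (by rw [h])
    have h1 : (1 : ℝ) ≤ |((j : ℕ) : ℝ) - (j' : ℕ)| := by
      have h2 : ((j : ℕ) : ℤ) - (j' : ℕ) ≠ 0 := fun h => hjj (Fin.ext (by omega))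
      exact_mod_cast Int.one_le_abs h2
    have h2 : levelCenter B m ⟨i, j⟩ - levelCenter B m ⟨i, j'⟩
        = (((j : ℕ) : ℝ) - (j' : ℕ)) * (2 * levelRadius B m i) := by
      simp only [levelCenter]; ring
    rw [h2, abs_mul, abs_of_nonneg (by positivity : 0 ≤ 2 * levelRadius B m i)]
    simp only
    nlinarith
  · rw [add_comm]
    exact (aux b' b h).trans (le_abs_self _)

theorem levelRadius_le_one (hB0 : 0 ≤ B) (hB : B ≤ 1 / 2) (b : (i : Fin K) × Fin (m i)) :
    levelRadius B m b.1 ≤ 1 := by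
  have hm : 1 ≤ m b.1 := (Nat.zero_le _).trans_lt b.2.2
  have hK : (1 : ℝ) ≤ K := by exact_mod_cast (Nat.zero_le _).trans_lt b.1.2
  have hm' : (1 : ℝ) ≤ m b.1 := by exact_mod_cast hm
  have h := card_mul_levelRadius_le hB0 hB hm
  have h1 : 1 / (K : ℝ) ≤ 1 := by rw [div_le_one (by positivity)]; exact hK
  have h0 := levelRadius_nonneg B m b.1
  nlinarith

/-- The radii are squares chosen so that every level contributes at most `B / K`. By
`volume_tentFamily_gap_le` this sum is what the margin condition with `α = 1/2` constrains, so `K`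
levels share one budget. -/
theorem sum_sqrt_levelRadius_le (hB0 : 0 ≤ B) :
    ∑ b : (i : Fin K) × Fin (m i), √(levelRadius B m b.1) ≤ B := by
  rw [Fintype.sum_sigma]
  have h : ∀ i : Fin K, ∑ _j : Fin (m i), √(levelRadius B m i) ≤ B / K := by
    intro i
    rw [Finset.sum_const, Finset.card_univ, Fintype.card_fin, nsmul_eq_mul, levelRadius,
      Real.sqrt_sq (by positivity)]
    rcases Nat.eq_zero_or_pos (m i) with h | h
    · rw [h]; simp; positivity
    · have : (0 : ℝ) < m i := by exact_mod_cast h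
      have hK : (0 : ℝ) < K := by exact_mod_cast (Nat.zero_le _).trans_lt i.2
      exact le_of_eq (by field_simp)
  refine (Finset.sum_le_sum fun i _ => h i).trans ?_
  rw [Finset.sum_const, Finset.card_univ, Fintype.card_fin, nsmul_eq_mul]
  rcases Nat.eq_zero_or_pos K with h | h
  · rw [h]; simpa using hB0
  · have : (K : ℝ) ≠ 0 := by exact_mod_cast h.ne'
    rw [mul_div_cancel₀ _ this]

/-- The family with `m i` tents of level `i`, for each `i`. -/
noncomputable def levelFamily {a : ℝ} (ha : 0 < a) (ha1 : a ≤ 1) (hB0 : 0 ≤ B) (hB : B ≤ 1 / 2)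
    (m : Fin K → ℕ) : BumpFamily ((i : Fin K) × Fin (m i)) :=
  tentFamily a (levelCenter B m) (fun b => levelRadius B m b.1) ha ha1
    (fun b => levelRadius_nonneg B m b.1) (levelRadius_le_one hB0 hB) (levelRadius_add_le hB0 hB)

variable {a : ℝ} (ha : 0 < a) (ha1 : a ≤ 1) (hB0 : 0 ≤ B) (hB : B ≤ 1 / 2)

theorem le_integral_levelFamily (b : (i : Fin K) × Fin (m i)) :
    a * levelRadius B m b.1 ^ 2 / 2 ≤ ∫ x, (levelFamily ha ha1 hB0 hB m).bump b x := by
  have hK : (0 : ℝ) < K := by exact_mod_cast (Nat.zero_le _).trans_lt b.1.2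
  refine le_integral_tent ha (levelRadius_nonneg B m b.1) ?_ ?_
  · have := le_levelCenter_sub (B := B) b
    have h0 : (0 : ℝ) ≤ ((b.1 : ℕ) : ℝ) / K := by positivity
    linarith
  · refine (levelCenter_add_le hB0 hB b).trans ?_
    rw [div_le_one hK]
    exact_mod_cast b.1.2

theorem le_sum_integral_levelFamily (i : Fin K) :
    m i * (a * levelRadius B m i ^ 2 / 2)
      ≤ ∑ b ∈ ({i} : Finset (Fin K)).sigma fun i => (Finset.univ : Finset (Fin (m i))),
        ∫ x, (levelFamily ha ha1 hB0 hB m).bump b x := by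
  rw [Finset.sum_sigma, Finset.sum_singleton]
  refine le_trans (le_of_eq ?_)
    (Finset.sum_le_sum fun j _ => le_integral_levelFamily ha ha1 hB0 hB ⟨i, j⟩)
  simp

/-- The squared tent integrates to order `r ^ 3 = (B / (K m)) ^ 6`, which is why about `n ^ (1 / 6)`
tents are used against `n` rounds. Two of the six factors `1 / K` provide the testing error `η = 1 /
K`. -/
theorem integral_levelFamily_sq_le {n : ℕ} (b : (i : Fin K) × Fin (m i)) (hn : n ≤ m b.1 ^ 6) :
    6 * (n * ∫ x, (levelFamily ha ha1 hB0 hB m).bump b x ^ 2) ≤ (1 / (K : ℝ)) ^ 2 := by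
  have hK : (1 : ℝ) ≤ K := by exact_mod_cast (Nat.zero_le _).trans_lt b.1.2
  have hm' : (1 : ℝ) ≤ m b.1 := by exact_mod_cast (Nat.zero_le _).trans_lt b.2.2
  have h1 : ∫ x, (levelFamily ha ha1 hB0 hB m).bump b x ^ 2 ≤ 2 * levelRadius B m b.1 ^ 3 :=
    integral_tent_sq_le ha ha1 (levelRadius_nonneg B m b.1) _
  have hn' : (n : ℝ) ≤ (m b.1 : ℝ) ^ 6 := by exact_mod_cast hn
  have h0 := levelRadius_nonneg B m b.1
  calc 6 * (n * ∫ x, (levelFamily ha ha1 hB0 hB m).bump b x ^ 2)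
      ≤ 6 * ((m b.1 : ℝ) ^ 6 * (2 * levelRadius B m b.1 ^ 3)) := by
        gcongr
    _ = 12 * B ^ 6 / (K : ℝ) ^ 4 * (1 / (K : ℝ)) ^ 2 := by
        unfold levelRadius; field_simp; ring
    _ ≤ (1 / (K : ℝ)) ^ 2 := by
        refine mul_le_of_le_one_left (by positivity) ?_
        rw [div_le_one (by positivity)]
        have h2 : B ^ 6 ≤ (1 / 2) ^ 6 := pow_le_pow_left₀ hB0 hB 6
        have h3 : (1 : ℝ) ≤ (K : ℝ) ^ 4 := one_le_pow₀ hK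
        norm_num at h2
        linarith

theorem levelFamily_mem_banditClass {c C L δ₀ D₀ : ℝ} (hc : c ≤ 1) (hC : 1 ≤ C) (haL : a ≤ 2 * L)
    (hBD : 2 * B ≤ D₀ * √a) (s : ((i : Fin K) × Fin (m i)) → Bool) :
    gapInstance ((levelFamily ha ha1 hB0 hB m).gap s)
      ((levelFamily ha ha1 hB0 hB m).measurable_gap s)
      ((levelFamily ha ha1 hB0 hB m).abs_gap_le_one s) ∈ banditClass c C L δ₀ D₀ (1 / 2) 1 := by
  refine gapInstance_mem_banditClass _ _ hc hC (fun x x' => ?_) fun δ h0 _ => ?_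
  · refine (abs_tentFamily_gap_sub_le ha ha1 _ _ _ s x x').trans ?_
    gcongr
  · refine (volume_tentFamily_gap_le ha ha1 _ _ _ s h0).trans ?_
    rw [← Real.sqrt_eq_rpow, Real.sqrt_div h0]
    have hs : 0 < √a := Real.sqrt_pos.2 ha
    calc 2 * (√δ / √a * ∑ b : (i : Fin K) × Fin (m i), √(levelRadius B m b.1))
        ≤ 2 * (√δ / √a * B) := by
          have := sum_sqrt_levelRadius_le (m := m) hB0
          gcongr
      _ = (2 * B) * (√δ / √a) := by ring
      _ ≤ (D₀ * √a) * (√δ / √a) := by gcongr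
      _ = D₀ * √δ := by field_simp

end Levels

/-! ### The constant gap, and the number of tents -/

/-- One bump which is constantly equal to one. -/
noncomputable def unitFamily : BumpFamily Unit where
  bump _ _ := 1
  measurable_bump _ := measurable_const
  nonneg _ _ := zero_le_one
  le_one _ _ := le_rfl
  mul_eq_zero b b' h := absurd (Subsingleton.elim b b') h

/-- The gap has absolute value `1 > δ₀`, so the margin condition concerns empty sets and holds for
every `α`. -/
theorem unitFamily_mem_banditClass {c C L δ₀ D₀ α : ℝ} (hc : c ≤ 1) (hC : 1 ≤ C) (hL : 0 < L)
    (hδ₀ : δ₀ < 1) (hD₀ : 0 < D₀) (s : Unit → Bool) :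
    gapInstance (unitFamily.gap s) (unitFamily.measurable_gap s) (unitFamily.abs_gap_le_one s)
      ∈ banditClass c C L δ₀ D₀ α 1 := by
  refine gapInstance_mem_banditClass _ _ hc hC (fun x x' => ?_) fun δ h0 h1 => ?_
  · have : unitFamily.gap s x = unitFamily.gap s x' := rfl
    rw [this, sub_self, abs_zero]; positivity
  · have : {x | 0 < |unitFamily.gap s x| ∧ |unitFamily.gap s x| ≤ δ} = ∅ := by
      refine Set.eq_empty_of_forall_notMem fun x hx => ?_
      have h2 := hx.2
      rw [unitFamily.abs_gap_eq_sum] at h2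
      simp [unitFamily] at h2
      linarith
    rw [this, measureReal_empty]
    positivity

theorem exists_nat_pow_six_ge (n : ℕ) :
    ∃ m : ℕ, 1 ≤ m ∧ n ≤ m ^ 6 ∧ (1 ≤ n → (m : ℝ) ^ 3 ≤ 8 * √n) := by
  have hx : (0 : ℝ) ≤ (n : ℝ) ^ (1 / 6 : ℝ) := by positivity
  have hx6 : ((n : ℝ) ^ (1 / 6 : ℝ)) ^ 6 = n := by
    rw [← Real.rpow_natCast, ← Real.rpow_mul (Nat.cast_nonneg n)]; norm_num
  have hx3 : ((n : ℝ) ^ (1 / 6 : ℝ)) ^ 3 = √n := by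
    rw [← Real.rpow_natCast, ← Real.rpow_mul (Nat.cast_nonneg n), Real.sqrt_eq_rpow]; norm_num
  set x := (n : ℝ) ^ (1 / 6 : ℝ) with hxdef
  rcases Nat.eq_zero_or_pos n with h | h
  · exact ⟨1, le_rfl, by simp [h], fun h1 => by omega⟩
  · have hx1 : 1 ≤ x := Real.one_le_rpow (by exact_mod_cast h) (by norm_num)
    refine ⟨⌈x⌉₊, Nat.one_le_ceil_iff.2 (by linarith), ?_, fun _ => ?_⟩
    · have : (n : ℝ) ≤ (⌈x⌉₊ : ℝ) ^ 6 := by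
        rw [← hx6]; exact pow_le_pow_left₀ hx (Nat.le_ceil x) 6
      exact_mod_cast this
    · have h1 : (⌈x⌉₊ : ℝ) ≤ 2 * x := by linarith [Nat.ceil_lt_add_one hx]
      calc (⌈x⌉₊ : ℝ) ^ 3 ≤ (2 * x) ^ 3 := pow_le_pow_left₀ (Nat.cast_nonneg _) h1 3
        _ = 8 * √n := by rw [← hx3]; ring

/-! ### Lower bounds for given times -/

section LowerBounds

variable {T M : ℕ} {S : Type*} [MeasurableSpace S] (π : BatchedPolicy T M S) (ν : Measure S)
  [IsProbabilityMeasure ν] {a B c C L δ₀ D₀ : ℝ}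

/-- A lower bound for all policies, whatever their batches are. -/
theorem exists_regret_ge_sqrt (ha : 0 < a) (ha1 : a ≤ 1) (hB0 : 0 < B)
    (hB : B ≤ 1 / 2) (hc : c ≤ 1) (hC : 1 ≤ C) (haL : a ≤ 2 * L) (hBD : 2 * B ≤ D₀ * √a)
    (hT : 1 ≤ T) :
    ∃ P ∈ banditClass c C L δ₀ D₀ (1 / 2) 1, a * B ^ 4 / 64 * √T ≤ π.regret ν P := by
  obtain ⟨m, hm1, hm6, hm3⟩ := exists_nat_pow_six_ge T
  have hT' : (0 : ℝ) < T := by exact_mod_cast hT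
  have hm' : (0 : ℝ) < m := by exact_mod_cast hm1
  obtain ⟨s, hs⟩ := π.exists_regret_ge
    (levelFamily (K := 1) ha ha1 hB0.le hB fun _ => m) ν fun b => by
      simpa using integral_levelFamily_sq_le ha ha1 hB0.le hB b hm6
  refine ⟨_, levelFamily_mem_banditClass ha ha1 hB0.le hB hc hC haL hBD s, le_trans ?_ hs⟩
  have hsum : m * (a * levelRadius (K := 1) B (fun _ => m) 0 ^ 2 / 2)
      ≤ ∑ b, ∫ x, (levelFamily (K := 1) ha ha1 hB0.le hB fun _ => m).bump b x := by
    refine (le_sum_integral_levelFamily ha ha1 hB0.le hB (m := fun _ : Fin 1 => m) 0).trans ?_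
    exact Finset.sum_le_sum_of_subset_of_nonneg (Finset.subset_univ _) fun b _ _ =>
      integral_nonneg fun x => (levelFamily (K := 1) ha ha1 hB0.le hB fun _ => m).nonneg b x
  have hval : (m : ℝ) * (a * levelRadius (K := 1) B (fun _ => m) 0 ^ 2 / 2)
      = a * B ^ 4 / 2 / (m : ℝ) ^ 3 := by
    simp only [levelRadius]; field_simp; simp
  have hsq : √(T : ℝ) * √T = T := Real.mul_self_sqrt hT'.le
  have hs0 : 0 < √(T : ℝ) := Real.sqrt_pos.2 hT'
  calc a * B ^ 4 / 64 * √T = (√T * √T) * (a * B ^ 4 / 2 / (8 * √T)) / 4 := by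
        field_simp; norm_num
    _ = T * (a * B ^ 4 / 2 / (8 * √T)) / 4 := by rw [hsq]
    _ ≤ T * (a * B ^ 4 / 2 / (m : ℝ) ^ 3) / 4 := by
        have := hm3 hT
        gcongr
    _ ≤ _ := by rw [hval] at hsum; gcongr

/-- For every choice of times `τ`, a batched policy suffers either from a long first batch, in an
instance with a constant gap, or from a later batch which is too long for what is known when it
starts. -/
theorem exists_regret_ge_batches (ha : 0 < a) (ha1 : a ≤ 1) (hB0 : 0 < B)
    (hB : B ≤ 1 / 2) (hc : c ≤ 1) (hC : 1 ≤ C) (haL : a ≤ 2 * L) (hBD : 2 * B ≤ D₀ * √a)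
    (hM : 0 < M) (hL : 0 < L) (hδ₀ : δ₀ < 1) (hD₀ : 0 < D₀) {τ : ℕ → ℕ}
    (h0 : τ 0 = 0) (hτ1 : ∀ i, 1 ≤ i → 1 ≤ τ i) (hτT : ∀ i ≤ M, τ i ≤ T) (hτ : τ M < T)
    (hmono : ∀ i < M, τ i ≤ τ (i + 1)) :
    (∃ P ∈ banditClass c C L δ₀ D₀ 1 1, (τ 1 : ℝ) / (4 * M) ≤ π.regret ν P) ∨
    ∃ i, 1 ≤ i ∧ i < M ∧ ∃ P ∈ banditClass c C L δ₀ D₀ (1 / 2) 1,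
      a * B ^ 4 / 64 * (1 / (M : ℝ)) ^ 5 * (((τ (i + 1) : ℝ) - τ i) / √(τ i)) ≤ π.regret ν P := by
  choose m hm1 hm6 hm3 using exists_nat_pow_six_ge
  -- One hypercube with a level for each index, fixed before the index `i` of the long batch is
  -- known. Level `0` is never used to force regret.
  set Φ := levelFamily (K := M) ha ha1 hB0.le hB fun i => m (τ i) with hΦ
  obtain ⟨i, hi, hmass⟩ := π.exists_longBatchMass_ge Φ ν hM hτ
  have hM' : (0 : ℝ) < M := by exact_mod_cast hM
  rcases Nat.eq_zero_or_pos i with h | h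
  · left
    subst h
    have hz : Nonempty (Fin T → I × (Bool → I)) := ⟨fun _ => (0, fun _ => 0)⟩
    obtain ⟨z₀⟩ := hz
    -- By `longBatchMass_zero` both masses are the same seed probability times the number of
    -- vertices, so the bound passes from `Φ` to the constant gap.
    have hmass' : 2 ^ Fintype.card Unit / (M : ℝ)
        ≤ ∫ u, π.longBatchMass unitFamily 0 (τ 0) (τ (0 + 1)) u ∂ν := by
      simp only [π.longBatchMass_zero _ hM _ _ _ z₀] at hmass ⊢
      rw [integral_const_mul, div_eq_mul_inv] at hmass ⊢
      exact mul_le_mul_of_nonneg_left (le_of_mul_le_mul_left hmass (by positivity)) (by positivity)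
    -- With `n = τ 0 = 0` no rewards have been seen, so even a gap of size `1` is undetectable.
    obtain ⟨s, hs⟩ := π.exists_regret_ge_of_longBatch unitFamily ν hi (hτT 1 hM) Finset.univ
      (fun b _ => by rw [h0]; simp) hmass'
    refine ⟨_, unitFamily_mem_banditClass hc hC hL hδ₀ hD₀ s, le_trans (le_of_eq ?_) hs⟩
    rw [h0]
    simp [unitFamily]
  · right
    refine ⟨i, h, hi, ?_⟩
    obtain ⟨s, hs⟩ := π.exists_regret_ge_of_longBatch Φ ν hi (hτT (i + 1) hi)
      (({⟨i, hi⟩} : Finset (Fin M)).sigma fun _ => Finset.univ) (fun b hb => by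
        have hb1 : b.1 = ⟨i, hi⟩ := by simpa using hb
        refine integral_levelFamily_sq_le ha ha1 hB0.le hB b ?_
        rw [hb1]
        exact hm6 (τ i)) hmass
    refine ⟨_, levelFamily_mem_banditClass ha ha1 hB0.le hB hc hC haL hBD s, le_trans ?_ hs⟩
    have hsum := le_sum_integral_levelFamily ha ha1 hB0.le hB (m := fun i : Fin M => m (τ i))
      ⟨i, hi⟩
    have hm' : (0 : ℝ) < m (τ i) := by exact_mod_cast hm1 (τ i)
    have hval : (m (τ i) : ℝ) * (a * levelRadius B (fun i : Fin M => m (τ i)) ⟨i, hi⟩ ^ 2 / 2)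
        = a * B ^ 4 / 2 / (M : ℝ) ^ 4 / (m (τ i) : ℝ) ^ 3 := by
      simp only [levelRadius]; field_simp
    have hτi : (0 : ℝ) < τ i := by exact_mod_cast hτ1 i h
    have hs0 : 0 < √(τ i : ℝ) := Real.sqrt_pos.2 hτi
    have hd : (0 : ℝ) ≤ (τ (i + 1) : ℝ) - τ i := by
      rw [sub_nonneg]; exact_mod_cast hmono i hi
    calc a * B ^ 4 / 64 * (1 / (M : ℝ)) ^ 5 * (((τ (i + 1) : ℝ) - τ i) / √(τ i))
        = ((τ (i + 1) : ℝ) - τ i) * (a * B ^ 4 / 2 / (M : ℝ) ^ 4 / (8 * √(τ i))) / (4 * M) := by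
          field_simp; ring
      _ ≤ ((τ (i + 1) : ℝ) - τ i) *
          (a * B ^ 4 / 2 / (M : ℝ) ^ 4 / (m (τ i) : ℝ) ^ 3) / (4 * M) := by
          have := hm3 (τ i) (hτ1 i h)
          gcongr
      _ ≤ _ := by rw [← hval]; gcongr

end LowerBounds

/-! ### Exponents -/

/-- The optimal exponent `(1 - γ) / (1 - γ ^ M)` of the regret with `M` batches. -/
noncomputable def batchExp (γ : ℝ) (M : ℕ) : ℝ := (1 - γ) / (1 - γ ^ M)

theorem batchExp_half_mul (M : ℕ) (hM : 2 ≤ M) :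
    batchExp (1 / 2) M * (1 - (1 / 2) ^ M) = 1 / 2 := by
  have h : (1 / 2 : ℝ) ^ M < 1 := pow_lt_one₀ (by norm_num) (by norm_num) (by omega)
  rw [batchExp, div_mul_cancel₀ _ (by linarith)]
  norm_num

theorem batchExp_two_thirds_mul (M : ℕ) (hM : 2 ≤ M) :
    batchExp (2 / 3) M * (1 - (2 / 3) ^ M) = 1 / 3 := by
  have h : (2 / 3 : ℝ) ^ M < 1 := pow_lt_one₀ (by norm_num) (by norm_num) (by omega)
  rw [batchExp, div_mul_cancel₀ _ (by linarith)]
  norm_num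

theorem half_pow_le (M : ℕ) (hM : 2 ≤ M) : (1 / 2 : ℝ) ^ M ≤ 1 / 4 := by
  have := pow_le_pow_of_le_one (by norm_num : (0 : ℝ) ≤ 1 / 2) (by norm_num) hM
  norm_num at this ⊢
  exact this

theorem batchExp_half_bounds (M : ℕ) (hM : 2 ≤ M) :
    1 / 2 ≤ batchExp (1 / 2) M ∧ batchExp (1 / 2) M ≤ 2 / 3 ∧
      batchExp (1 / 2) M ≤ 1 / 2 + 2 / 3 * (1 / 2) ^ M := by
  have h := batchExp_half_mul M hM
  have h1 := half_pow_le M hM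
  have h0 : (0 : ℝ) < (1 / 2) ^ M := by positivity
  set e := batchExp (1 / 2) M
  have he0 : 0 < e := by nlinarith
  have he1 : e ≤ 2 / 3 := by nlinarith
  exact ⟨by nlinarith, he1, by nlinarith⟩

theorem batchExp_two_thirds_bounds (M : ℕ) (hM : 2 ≤ M) :
    1 / 3 ≤ batchExp (2 / 3) M ∧ batchExp (2 / 3) M ≤ 3 / 5 ∧
      batchExp (2 / 3) M < batchExp (1 / 2) M := by
  have h := batchExp_two_thirds_mul M hM
  have h0 : (0 : ℝ) < (2 / 3) ^ M := by positivity
  have h1 : (2 / 3 : ℝ) ^ M ≤ 4 / 9 := by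
    have := pow_le_pow_of_le_one (by norm_num : (0 : ℝ) ≤ 2 / 3) (by norm_num) hM
    norm_num at this ⊢
    exact this
  have hb := (batchExp_half_bounds M hM).1
  have he0 : 0 < batchExp (2 / 3) M := by nlinarith
  refine ⟨by nlinarith, by nlinarith, ?_⟩
  -- For `M ≥ 3` the exponent at `2 / 3` is below `1 / 2`, which bounds the other one from below.
  -- For `M = 2` it is `3 / 5`, and the comparison with `2 / 3` is made directly.
  rcases Nat.eq_or_lt_of_le hM with h2 | h2
  · subst h2
    norm_num [batchExp]
  · have h3 : (2 / 3 : ℝ) ^ M ≤ 8 / 27 := by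
      have := pow_le_pow_of_le_one (by norm_num : (0 : ℝ) ≤ 2 / 3) (by norm_num)
        (show 3 ≤ M by omega)
      norm_num at this ⊢
      exact this
    nlinarith

/-- The gain in the exponent. -/
noncomputable def expGain (M : ℕ) : ℝ :=
  (1 / 2) ^ M * (batchExp (1 / 2) M - batchExp (2 / 3) M) / 2

theorem expGain_pos (M : ℕ) (hM : 2 ≤ M) : 0 < expGain M := by
  have := (batchExp_two_thirds_bounds M hM).2.2
  have h : 0 < batchExp (1 / 2) M - batchExp (2 / 3) M := by linarith
  unfold expGain; positivity

/-- For horizons with `T ^ ((1 / 2) ^ M) < 4` this makes the target rate at `α = 1/2` at most `4 *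
√T`. -/
theorem batchExp_half_add_expGain_le (M : ℕ) (hM : 2 ≤ M) :
    batchExp (1 / 2) M + expGain M ≤ 1 / 2 + (1 / 2) ^ M := by
  obtain ⟨-, h2, h3⟩ := batchExp_half_bounds M hM
  have h4 := (batchExp_two_thirds_bounds M hM).1
  have h0 : (0 : ℝ) < (1 / 2) ^ M := by positivity
  unfold expGain
  nlinarith

/-- The exponents of the critical times. -/
noncomputable def timeExp (M i : ℕ) : ℝ :=
  2 * (batchExp (1 / 2) M + expGain M)
    - 2 * (1 / 2) ^ i * (2 * batchExp (1 / 2) M + expGain M - batchExp (2 / 3) M)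

theorem timeExp_one (M : ℕ) : timeExp M 1 = batchExp (2 / 3) M + expGain M := by
  unfold timeExp; ring

/-- The recursion behind the closed form: the ratio `τ (i + 1) / √(τ i)` has the same exponent for
all later batches, that of the target rate at `α = 1/2`. The starting value in `timeExp_one` is the
target rate at `α = 1`. -/
theorem timeExp_succ (M i : ℕ) :
    timeExp M (i + 1) - timeExp M i / 2 = batchExp (1 / 2) M + expGain M := by
  unfold timeExp; ring

theorem timeExp_factor_ge (M : ℕ) (hM : 2 ≤ M) :
    2 / 5 ≤ 2 * batchExp (1 / 2) M + expGain M - batchExp (2 / 3) M := by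
  have h1 := (batchExp_half_bounds M hM).1
  have h2 := (batchExp_two_thirds_bounds M hM).2.1
  have h3 := expGain_pos M hM
  linarith

theorem timeExp_mono (M : ℕ) (hM : 2 ≤ M) {i j : ℕ} (hij : i ≤ j) :
    timeExp M i ≤ timeExp M j := by
  have h1 := timeExp_factor_ge M hM
  have h2 := pow_le_pow_of_le_one (by norm_num : (0 : ℝ) ≤ 1 / 2) (by norm_num) hij
  unfold timeExp
  nlinarith

/-- Without the gain and with first exponent `batchExp (1 / 2) M`, the last exponent would be
exactly `1`. Starting lower, at `batchExp (2 / 3) M`, takes off `4 * expGain M`, and the gain in the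
recursion gives back less than `2 * expGain M`. -/
theorem timeExp_last_lt_one (M : ℕ) (hM : 2 ≤ M) : timeExp M M < 1 := by
  have h1 := batchExp_half_mul M hM
  have h2 := expGain_pos M hM
  have h0 : (0 : ℝ) < (1 / 2) ^ M := by positivity
  have h3 : (1 / 2 : ℝ) ^ M * (batchExp (1 / 2) M - batchExp (2 / 3) M) = 2 * expGain M := by
    unfold expGain; ring
  unfold timeExp
  nlinarith

theorem timeExp_succ_sub_ge (M : ℕ) (hM : 2 ≤ M) {i : ℕ} (hi : i < M) :
    (1 / 2) ^ M / 2 ≤ timeExp M (i + 1) - timeExp M i := by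
  have h1 := timeExp_factor_ge M hM
  have h2 := pow_le_pow_of_le_one (by norm_num : (0 : ℝ) ≤ 1 / 2) (by norm_num)
    (show i + 1 ≤ M from hi)
  have h0 : (0 : ℝ) < (1 / 2) ^ M := by positivity
  have h3 : timeExp M (i + 1) - timeExp M i = 2 * (1 / 2) ^ (i + 1)
      * (2 * batchExp (1 / 2) M + expGain M - batchExp (2 / 3) M) := by
    unfold timeExp; ring
  rw [h3]
  nlinarith

theorem third_le_timeExp (M : ℕ) (hM : 2 ≤ M) {i : ℕ} (hi : 1 ≤ i) : 1 / 3 ≤ timeExp M i := by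
  have h1 := timeExp_mono M hM hi
  rw [timeExp_one] at h1
  linarith [(batchExp_two_thirds_bounds M hM).1, expGain_pos M hM]

/-! ### Critical times -/

/-- The critical times. -/
noncomputable def criticalTime (T M i : ℕ) : ℕ := if i = 0 then 0 else ⌊(T : ℝ) ^ timeExp M i⌋₊

section CriticalTimes

variable {T M : ℕ}

theorem one_lt_of_four_le_rpow (hT : 4 ≤ (T : ℝ) ^ ((1 / 2 : ℝ) ^ M)) : 1 < (T : ℝ) := by
  by_contra h
  have := Real.rpow_le_one (Nat.cast_nonneg T) (not_lt.1 h) (by positivity : 0 ≤ (1 / 2 : ℝ) ^ M)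
  linarith

theorem four_le_rpow_timeExp (hM : 2 ≤ M) (hT : 4 ≤ (T : ℝ) ^ ((1 / 2 : ℝ) ^ M))
    {i : ℕ} (hi : 1 ≤ i) : 4 ≤ (T : ℝ) ^ timeExp M i := by
  have h1 := (one_lt_of_four_le_rpow hT).le
  refine hT.trans (Real.rpow_le_rpow_of_exponent_le h1 ?_)
  linarith [third_le_timeExp M hM hi, half_pow_le M hM]

theorem criticalTime_le (T M : ℕ) {i : ℕ} (hi : 1 ≤ i) :
    (criticalTime T M i : ℝ) ≤ (T : ℝ) ^ timeExp M i := by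
  rw [criticalTime, if_neg (by omega)]
  exact Nat.floor_le (by positivity)

theorem lt_criticalTime_add_one (T M : ℕ) {i : ℕ} (hi : 1 ≤ i) :
    (T : ℝ) ^ timeExp M i < criticalTime T M i + 1 := by
  rw [criticalTime, if_neg (by omega)]
  exact Nat.lt_floor_add_one _

theorem two_mul_rpow_timeExp_le (hM : 2 ≤ M) (hT : 4 ≤ (T : ℝ) ^ ((1 / 2 : ℝ) ^ M))
    {i : ℕ} (hi : i < M) :
    2 * (T : ℝ) ^ timeExp M i ≤ (T : ℝ) ^ timeExp M (i + 1) := by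
  have h1 := one_lt_of_four_le_rpow hT
  have h0 : 0 < (T : ℝ) := by linarith
  -- Consecutive exponents differ by at least `(1 / 2) ^ M / 2`, so the threshold `4` makes
  -- consecutive times double.
  have h2 : 2 ≤ (T : ℝ) ^ ((1 / 2 : ℝ) ^ M / 2) := by
    have h3 : (T : ℝ) ^ ((1 / 2 : ℝ) ^ M / 2) * (T : ℝ) ^ ((1 / 2 : ℝ) ^ M / 2)
        = (T : ℝ) ^ ((1 / 2 : ℝ) ^ M) := by
      rw [← Real.rpow_add h0, add_halves]
    have h4 : 0 ≤ (T : ℝ) ^ ((1 / 2 : ℝ) ^ M / 2) := by positivity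
    nlinarith
  calc 2 * (T : ℝ) ^ timeExp M i
      ≤ (T : ℝ) ^ (timeExp M (i + 1) - timeExp M i) * (T : ℝ) ^ timeExp M i :=
        mul_le_mul_of_nonneg_right (h2.trans (Real.rpow_le_rpow_of_exponent_le h1.le
          (timeExp_succ_sub_ge M hM hi))) (by positivity)
    _ = _ := by rw [← Real.rpow_add h0, sub_add_cancel]

theorem criticalTime_lt (hM : 2 ≤ M) (hT : 4 ≤ (T : ℝ) ^ ((1 / 2 : ℝ) ^ M))
    {i : ℕ} (hi : i ≤ M) : criticalTime T M i < T := by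
  have h1 := one_lt_of_four_le_rpow hT
  rcases Nat.eq_zero_or_pos i with h | h
  · rw [criticalTime, if_pos h]; exact_mod_cast (zero_lt_one.trans h1)
  · have h2 := criticalTime_le T M h
    have h3 : (T : ℝ) ^ timeExp M i < T := by
      conv_rhs => rw [← Real.rpow_one (T : ℝ)]
      exact Real.rpow_lt_rpow_of_exponent_lt h1
        ((timeExp_mono M hM hi).trans_lt (timeExp_last_lt_one M hM))
    exact_mod_cast h2.trans_lt h3

/-- Doubling leaves half of the later power for the difference, and the rounding loss of at most `1`
is absorbed by another quarter. -/
theorem criticalTime_succ_sub_ge (hM : 2 ≤ M) (hT : 4 ≤ (T : ℝ) ^ ((1 / 2 : ℝ) ^ M))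
    {i : ℕ} (hi : 1 ≤ i) (hiM : i < M) :
    (T : ℝ) ^ timeExp M (i + 1) / 4 ≤ (criticalTime T M (i + 1) : ℝ) - criticalTime T M i := by
  have h1 := four_le_rpow_timeExp hM hT hi
  have h2 := two_mul_rpow_timeExp_le hM hT hiM
  have h3 := criticalTime_le T M hi
  have h4 := lt_criticalTime_add_one T M (Nat.succ_le_succ (Nat.zero_le i))
  linarith

theorem one_le_criticalTime (hM : 2 ≤ M) (hT : 4 ≤ (T : ℝ) ^ ((1 / 2 : ℝ) ^ M))
    {i : ℕ} (hi : 1 ≤ i) : 1 ≤ criticalTime T M i := by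
  have h1 := four_le_rpow_timeExp hM hT hi
  rw [criticalTime, if_neg (by omega)]
  exact Nat.le_floor (by push_cast; linarith)

theorem criticalTime_le_succ (hM : 2 ≤ M) (hT : 4 ≤ (T : ℝ) ^ ((1 / 2 : ℝ) ^ M))
    {i : ℕ} (hi : i < M) : criticalTime T M i ≤ criticalTime T M (i + 1) := by
  rcases Nat.eq_zero_or_pos i with h | h
  · rw [criticalTime, if_pos h]; exact Nat.zero_le _
  · have h1 := criticalTime_succ_sub_ge hM hT h hi
    have h2 : 0 ≤ (T : ℝ) ^ timeExp M (i + 1) := by positivity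
    have h3 : (criticalTime T M i : ℝ) ≤ criticalTime T M (i + 1) := by linarith
    exact_mod_cast h3

theorem rpow_batchExp_half_le (hM : 2 ≤ M) (hT : 4 ≤ (T : ℝ) ^ ((1 / 2 : ℝ) ^ M))
    {i : ℕ} (hi : 1 ≤ i) (hiM : i < M) :
    (T : ℝ) ^ (batchExp (1 / 2) M + expGain M) / 4
      ≤ ((criticalTime T M (i + 1) : ℝ) - criticalTime T M i) / √(criticalTime T M i) := by
  have h1 := one_lt_of_four_le_rpow hT
  have h0 : 0 < (T : ℝ) := by linarith
  have hτ : (0 : ℝ) < criticalTime T M i := by exact_mod_cast one_le_criticalTime hM hT hi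
  have hs : √(criticalTime T M i : ℝ) ≤ (T : ℝ) ^ (timeExp M i / 2) := by
    refine Real.sqrt_le_iff.2 ⟨by positivity, (criticalTime_le T M hi).trans (le_of_eq ?_)⟩
    rw [pow_two, ← Real.rpow_add h0, add_halves]
  rw [le_div_iff₀ (Real.sqrt_pos.2 hτ)]
  refine le_trans ?_ (criticalTime_succ_sub_ge hM hT hi hiM)
  calc (T : ℝ) ^ (batchExp (1 / 2) M + expGain M) / 4 * √(criticalTime T M i)
      ≤ (T : ℝ) ^ (batchExp (1 / 2) M + expGain M) / 4 * (T : ℝ) ^ (timeExp M i / 2) := by gcongr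
    _ = (T : ℝ) ^ timeExp M (i + 1) / 4 := by
        rw [div_mul_eq_mul_div, ← Real.rpow_add h0, ← timeExp_succ M i, sub_add_cancel]

end CriticalTimes

/-! ### The theorem -/

theorem gammaExp_one_half : gammaExp 1 1 (1 / 2) = 1 / 2 := by norm_num [gammaExp]

theorem gammaExp_one_one : gammaExp 1 1 1 = 2 / 3 := by norm_num [gammaExp]

theorem BatchedPolicy.horizon_pos {T M : ℕ} {S : Type*} [MeasurableSpace S]
    (π : BatchedPolicy T M S) (hM : 0 < M) (u : S) : 1 ≤ T := by
  have h1 := π.grid_lt u (fun _ => 0) (fun _ => 0) 0 hM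
  have h2 := π.grid_mono u (fun _ => 0) (fun _ => 0) (show 0 + 1 ≤ M from hM) le_rfl
  rw [π.grid_last] at h2
  omega

theorem theorem5 (c C L δ₀ D₀ : ℝ) (hc : 0 < c) (hc1 : c ≤ 1) (hC : 1 ≤ C) (hL : 0 < L)
    (hδ₀ : 0 < δ₀) (hδ₀1 : δ₀ < 1) (hD₀ : 0 < D₀) :
    ∃ D₃ > (0 : ℝ), ∃ D₄ > (0 : ℝ), ∀ M : ℕ, 2 ≤ M → ∃ κ₁ > (0 : ℝ),
      ∀ (T : ℕ) (S : Type*) [MeasurableSpace S] (ν : Measure S) [IsProbabilityMeasure ν]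
        (π : BatchedPolicy T M S),
        ∃ α : ℝ, 0 < α ∧ α ≤ 1 ∧
          ((D₃ * (T : ℝ) ^ ((1 - gammaExp 1 1 α) / (1 - gammaExp 1 1 α ^ M) + κ₁)
              * (1 / (M : ℝ)) ^ D₄ : ℝ) : EReal)
            ≤ ⨆ P ∈ banditClass c C L δ₀ D₀ α 1, ((π.regret ν P : ℝ) : EReal) := by
  -- The slope `a` keeps the tents below `1` and the means Lipschitz. The budget `B` makes the tents
  -- fit into `[0, 1]` and meets the margin constant `D₀`.
  set a : ℝ := min 1 L
  set B : ℝ := min (1 / 2) (D₀ * √a / 2)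
  have ha : 0 < a := lt_min one_pos hL
  have ha1 : a ≤ 1 := min_le_left _ _
  have haL : a ≤ 2 * L := (min_le_right 1 L).trans (by linarith)
  have hB0 : 0 < B := lt_min (by norm_num) (by positivity)
  have hB : B ≤ 1 / 2 := min_le_left _ _
  have hBD : 2 * B ≤ D₀ * √a := by
    have : B ≤ D₀ * √a / 2 := min_le_right _ _
    linarith
  have hD1 : a * B ^ 4 ≤ 1 :=
    mul_le_one₀ ha1 (by positivity) (pow_le_one₀ hB0.le (hB.trans (by norm_num)))
  -- The constant `256` is `64 * 4`. The factor `4` pays for `T ^ ((1 / 2) ^ M) < 4` at small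
  -- horizons and for the rounding in `rpow_batchExp_half_le` at large ones; the case of a long
  -- first batch has room to spare.
  refine ⟨a * B ^ 4 / 256, by positivity, ((5 : ℕ) : ℝ), by norm_num, fun M hM =>
    ⟨expGain M, expGain_pos M hM, fun T S _ ν _ π => ?_⟩⟩
  obtain ⟨u⟩ : Nonempty S := ν.nonempty_of_neZero
  have hM0 : 0 < M := by omega
  have hMr : (1 : ℝ) ≤ M := by exact_mod_cast hM0
  have hT1 : 1 ≤ T := π.horizon_pos hM0 u
  have hT1' : (1 : ℝ) ≤ T := by exact_mod_cast hT1
  have hT0 : (0 : ℝ) < T := by linarith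
  have hMpow : (1 / (M : ℝ)) ^ 5 ≤ 1 :=
    pow_le_one₀ (by positivity) (by rw [div_le_one (by positivity)]; exact hMr)
  rw [Real.rpow_natCast]
  have fin : ∀ (α x : ℝ), (∃ P ∈ banditClass c C L δ₀ D₀ α 1, x ≤ π.regret ν P) →
      ((x : ℝ) : EReal) ≤ ⨆ P ∈ banditClass c C L δ₀ D₀ α 1, ((π.regret ν P : ℝ) : EReal) := by
    rintro α x ⟨P, hP, hx⟩
    exact le_iSup₂_of_le P hP (EReal.coe_le_coe_iff.2 hx)
  rcases lt_or_ge ((T : ℝ) ^ ((1 / 2 : ℝ) ^ M)) 4 with hT | hT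
  -- At small horizons the target exceeds `√T` by at most a constant factor, so the batches play no
  -- role.
  · refine ⟨1 / 2, by norm_num, by norm_num, fin _ _ ?_⟩
    obtain ⟨P, hP, hreg⟩ := exists_regret_ge_sqrt π ν ha ha1 hB0 hB hc1 hC haL hBD hT1
    refine ⟨P, hP, le_trans ?_ hreg⟩
    rw [gammaExp_one_half]
    change a * B ^ 4 / 256 * (T : ℝ) ^ (batchExp (1 / 2) M + expGain M) * (1 / (M : ℝ)) ^ 5 ≤ _
    have h1 : (T : ℝ) ^ (batchExp (1 / 2) M + expGain M) ≤ √T * 4 := by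
      refine (Real.rpow_le_rpow_of_exponent_le hT1' (batchExp_half_add_expGain_le M hM)).trans ?_
      rw [Real.rpow_add hT0, ← Real.sqrt_eq_rpow]
      gcongr
    calc a * B ^ 4 / 256 * (T : ℝ) ^ (batchExp (1 / 2) M + expGain M) * (1 / (M : ℝ)) ^ 5
        ≤ a * B ^ 4 / 256 * (√T * 4) * 1 := by gcongr
      _ = a * B ^ 4 / 64 * √T := by ring
  · rcases exists_regret_ge_batches π ν ha ha1 hB0 hB hc1 hC haL hBD hM0 hL hδ₀1 hD₀
      (τ := criticalTime T M) (by simp [criticalTime]) (fun i hi => one_le_criticalTime hM hT hi)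
      (fun i hi => (criticalTime_lt hM hT hi).le) (criticalTime_lt hM hT le_rfl)
      (fun i hi => criticalTime_le_succ hM hT hi) with ⟨P, hP, hreg⟩ | ⟨i, hi, hiM, P, hP, hreg⟩
    · refine ⟨1, one_pos, le_rfl, fin _ _ ⟨P, hP, le_trans ?_ hreg⟩⟩
      rw [gammaExp_one_one]
      change a * B ^ 4 / 256 * (T : ℝ) ^ (batchExp (2 / 3) M + expGain M) * (1 / (M : ℝ)) ^ 5 ≤ _
      rw [← timeExp_one]
      have h1 := four_le_rpow_timeExp hM hT (le_refl 1)
      have h2 := lt_criticalTime_add_one T M (le_refl 1)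
      have h3 : (1 / (M : ℝ)) ^ 5 ≤ 1 / M :=
        pow_le_of_le_one (by positivity) (by rw [div_le_one (by positivity)]; exact hMr)
          (by norm_num)
      calc a * B ^ 4 / 256 * (T : ℝ) ^ timeExp M 1 * (1 / (M : ℝ)) ^ 5
          ≤ 1 / 256 * (2 * criticalTime T M 1) * (1 / M) := by
            have h4 : (T : ℝ) ^ timeExp M 1 ≤ 2 * criticalTime T M 1 := by linarith
            gcongr
        _ = criticalTime T M 1 / (4 * M) / 32 := by field_simp; ring
        _ ≤ criticalTime T M 1 / (4 * M) := div_le_self (by positivity) (by norm_num)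
    · refine ⟨1 / 2, by norm_num, by norm_num, fin _ _ ⟨P, hP, le_trans ?_ hreg⟩⟩
      rw [gammaExp_one_half]
      change a * B ^ 4 / 256 * (T : ℝ) ^ (batchExp (1 / 2) M + expGain M) * (1 / (M : ℝ)) ^ 5 ≤ _
      calc a * B ^ 4 / 256 * (T : ℝ) ^ (batchExp (1 / 2) M + expGain M) * (1 / (M : ℝ)) ^ 5
          = a * B ^ 4 / 64 * (1 / (M : ℝ)) ^ 5
              * ((T : ℝ) ^ (batchExp (1 / 2) M + expGain M) / 4) := by ring
        _ ≤ _ := mul_le_mul_of_nonneg_left (rpow_batchExp_half_le hM hT hi hiM) (by positivity)
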